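/- Let $\Sigma$ be a connected smooth surface, let $\Phi:\Sigma\to\mathbb R^3$ be a smooth immersion and let $N:\Sigma\to\mathbb R^3$ be a smooth unit normal vector field along $\Phi$. Let $S_p:T_p\Sigma\to T_p\Sigma$ be the shape operator, given by $d\Phi_p(S_pX)=-dN_p(X)$, and let $K=\det S$ and $H=\tfrac12\operatorname{tr}S$ be the Gauss curvature and the mean curvature. Let $\vec v\in\mathbb R^3$ be a unit vector. For $\lambda\in\mathbb R$, the surface is called a $\lambda$-translating soliton of the Gauss curvature flow (with direction $\vec v$) if $$K=\langle N,\vec v\rangle+\lambda\quad\text{on }\Sigma.$$ Planes and circular cylinders are the only $\lambda$-translating solitons with constant mean curvature. Precisely: 1. If $\Sigma$ is a $\lambda$-translating soliton for some $\lambda\in\mathbb R$ and $H$ is constant, then $\Phi(\Sigma)$ is contained in a plane or in a right circular cylinder of some radius $r>0$. 2. Conversely, if $\Phi(\Sigma)$ is contained in a plane, then $H$ is constant and $\Sigma$ is a $\lambda$-translating soliton for some $\lambda\in\mathbb R$. 3. If $\Phi(\Sigma)$ is contained in a circular cylinder of some radius $r>0$ whose axis is parallel to $\vec v$, then $H$ is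 constant and $\Sigma$ is a $0$-translating soliton. -/

import Mathlib

open scoped Manifold ContDiff InnerProductSpace

/-- Euclidean three-space. -/
abbrev E3 : Type := EuclideanSpace ℝ (Fin 3)

namespace GaussFlow

noncomputable section

section Surfaces

variable {M : Type*} [TopologicalSpace M] [ChartedSpace (EuclideanSpace ℝ (Fin 2)) M]

/-- The differential at `p` of an `E3`-valued map on the surface `M`. -/
def differential (F : M → E3) (p : M) : TangentSpace (𝓡 2) p →L[ℝ] E3 :=
  mfderiv (𝓡 2) 𝓘(ℝ, E3) F p

/-- `Φ` is a smooth immersion of the surface `M` into Euclidean space, and `N` is a smooth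
unit normal vector field along it (its Gauss map). -/
structure IsOrientedImmersion (Φ N : M → E3) : Prop where
  smooth : ContMDiff (𝓡 2) 𝓘(ℝ, E3) ∞ Φ
  injective_differential : ∀ p : M, Function.Injective (differential Φ p)
  smooth_normal : ContMDiff (𝓡 2) 𝓘(ℝ, E3) ∞ N
  norm_normal : ∀ p : M, ‖N p‖ = 1
  normal_orthogonal : ∀ (p : M) (X : TangentSpace (𝓡 2) p), ⟪N p, differential Φ p X⟫_ℝ = 0

/-- The shape operator `S` on the tangent plane at `p`, determined by `dΦ(S X) = -dN(X)`:
the injective map `dΦ` is inverted on its range, in which `dN` takes its values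
(see `IsOrientedImmersion.differential_shapeOperator`). -/
def shapeOperator (Φ N : M → E3) (p : M) :
    TangentSpace (𝓡 2) p →ₗ[ℝ] TangentSpace (𝓡 2) p :=
  -((differential Φ p : TangentSpace (𝓡 2) p →ₗ[ℝ] E3).leftInverse ∘ₗ
    (differential N p : TangentSpace (𝓡 2) p →ₗ[ℝ] E3))

/-- The Gauss curvature, the product of the principal curvatures. -/
def gaussCurvature (Φ N : M → E3) (p : M) : ℝ :=
  LinearMap.det (shapeOperator Φ N p)

/-- The mean curvature, the average of the principal curvatures. -/
def meanCurvature (Φ N : M → E3) (p : M) : ℝ :=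
  LinearMap.trace ℝ (TangentSpace (𝓡 2) p) (shapeOperator Φ N p) / 2

/-- The mean curvature is the same at all points of the surface. -/
def HasConstantMeanCurvature (Φ N : M → E3) : Prop :=
  ∃ H : ℝ, ∀ p : M, meanCurvature Φ N p = H

/-- The equation `K = ⟨N, v⟩ + l` of an `l`-translating soliton of the Gauss curvature flow
with direction `v`. -/
def IsTranslatingSoliton (Φ N : M → E3) (v : E3) (l : ℝ) : Prop :=
  ∀ p : M, gaussCurvature Φ N p = ⟪N p, v⟫_ℝ + l

end Surfaces

/-- The plane through `a` with (unit) normal vector `w`. -/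
def plane (a w : E3) : Set E3 := {x | ⟪x - a, w⟫_ℝ = 0}

/-- The circular cylinder of radius `r` whose axis passes through `a` with (unit) direction
`u`: the points at distance `r` from the axis. -/
def circularCylinder (a u : E3) (r : ℝ) : Set E3 :=
  {x | ‖(x - a) - ⟪x - a, u⟫_ℝ • u‖ = r}

section Wellposedness

variable {M : Type*} [TopologicalSpace M] [ChartedSpace (EuclideanSpace ℝ (Fin 2)) M]

/-- The differential of a unit normal field is tangential. -/
theorem IsOrientedImmersion.inner_differential_normal {Φ N : M → E3} (h : IsOrientedImmersion Φ N)
    (p : M) (X : TangentSpace (𝓡 2) p) : ⟪N p, differential N p X⟫_ℝ = 0 := by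
  have hN : MDifferentiableAt (𝓡 2) 𝓘(ℝ, E3) N p :=
    (h.smooth_normal p).mdifferentiableAt (by simp)
  have h1 : HasMFDerivAt (𝓡 2) 𝓘(ℝ, E3) N p (differential N p) := hN.hasMFDerivAt
  have h2 : HasFDerivAt (fun y : E3 => ⟪y, y⟫_ℝ)
      ((2 : ℝ) • innerSL ℝ (N p)) (N p) := by
    have := (hasStrictFDerivAt_norm_sq (N p)).hasFDerivAt
    rw [← Nat.cast_smul_eq_nsmul ℝ] at this
    simpa [real_inner_self_eq_norm_sq] using this
  have h3 := h2.hasMFDerivAt.comp p h1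
  have h4 : ((fun y : E3 => ⟪y, y⟫_ℝ) ∘ N) = fun _ => (1 : ℝ) := by
    funext q
    simp [h.norm_normal q]
  rw [h4] at h3
  have h5 := hasMFDerivAt_unique h3 (hasMFDerivAt_const (1 : ℝ) p)
  have h6 := congrArg (fun L => L X) h5
  have h7 : (2 : ℝ) * ⟪N p, differential N p X⟫_ℝ = 0 := h6
  linarith

/-- The equation that determines the shape operator. -/
theorem IsOrientedImmersion.differential_shapeOperator {Φ N : M → E3} (h : IsOrientedImmersion Φ N)
    (p : M) (X : TangentSpace (𝓡 2) p) :
    differential Φ p (shapeOperator Φ N p X) = -differential N p X := by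
  set A : TangentSpace (𝓡 2) p →ₗ[ℝ] E3 := (differential Φ p : TangentSpace (𝓡 2) p →ₗ[ℝ] E3) with hA
  have hinj : Function.Injective A := h.injective_differential p
  have hle : LinearMap.range A ≤ (ℝ ∙ N p)ᗮ := by
    rintro _ ⟨Y, rfl⟩
    rw [Submodule.mem_orthogonal_singleton_iff_inner_right]
    exact h.normal_orthogonal p Y
  have hN0 : N p ≠ 0 := by
    intro h0
    have := h.norm_normal p
    simp [h0] at this
  have hdim : Module.finrank ℝ (LinearMap.range A) = Module.finrank ℝ (ℝ ∙ N p)ᗮ := by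
    have : Fact (Module.finrank ℝ E3 = 2 + 1) := ⟨by simp⟩
    rw [LinearMap.finrank_range_of_inj hinj, Submodule.finrank_orthogonal_span_singleton (n := 2) hN0]
    exact finrank_euclideanSpace_fin
  have heq := Submodule.eq_of_le_of_finrank_eq hle hdim
  have hmem : differential N p X ∈ LinearMap.range A := by
    rw [heq, Submodule.mem_orthogonal_singleton_iff_inner_right]
    exact h.inner_differential_normal p X
  obtain ⟨Y, hY⟩ := hmem
  have hS : shapeOperator Φ N p X = -Y := by
    change -(A.leftInverse (differential N p X)) = -Y
    rw [← hY, LinearMap.leftInverse_apply_of_inj (LinearMap.ker_eq_bot.mpr hinj)]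
  rw [hS, map_neg]
  exact congrArg Neg.neg hY

end Wellposedness

end

end GaussFlow

namespace GaussFlow

open Filter Topology

/-! Everything rests on the angle function n = ⟨N, v⟩: constant H together with the soliton equation
forces n to be constant. Where v is not normal, the tangential part T of v and its rotation W form
an orthogonal frame of equal lengths. In this frame S has rows (H + a, b) and (b, H - a), and the
soliton equation becomes a² + b² = k - n with k = H² - l. The derivatives of n along the frame are
expressed through a and b. Differentiating the norm equation and adding the two Codazzi equations
gives four linear equations for the four derivatives of a and b. The system is therefore closed, and
the commutator of the frame yields an algebraic relation (`SolitonSystem.integrability`). If b ≠ 0,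
differentiating that relation once more along Y makes n a root of a fixed quadratic; if b vanishes
on an open set, the equation for the Y-derivative of b does the same. Hence dn = 0
(`SolitonSystem.fderiv_eq_zero`), so a = -H and b = 0, and Codazzi leaves nH = 0.

Globally, n is constant by connectedness. If n² = 1, then N is constant and the surface is planar.
Otherwise T is principal with curvature 0 (`IsOrientedImmersion.differential_normal_eq`). If H = 0,
then N is again constant. If H ≠ 0, then n = 0 and the point PΦ + N/(2H), with P the projection
along v, is fixed: it is the centre of the cross-section of a cylinder.

For the converse, the normal of a plane, or the radial vector of a cylinder, is a multiple of N
whose sign is fixed by connectedness. -/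

theorem two_le_infty : (2 : WithTop ℕ∞) ≤ ∞ := WithTop.coe_le_coe.2 (le_top : (2 : ℕ∞) ≤ ⊤)

/-! ### The overdetermined system for n, a, b and its integrability -/

section ScalarSystem

/-- The first derivatives of the components `a`, `b` of the traceless part of the shape operator
along a frame `X`, `Y`, from the Codazzi equations and the derivatives of `a ^ 2 + b ^ 2`. -/
theorem codazzi_solve {H n a b q Xa Xb Ya Yb : ℝ} (hm : a ^ 2 + b ^ 2 ≠ 0)
    (h1 : Xb - Ya = -2 * H * n * b) (h2 : Xa + Yb = -2 * n * (a * H - (a ^ 2 + b ^ 2)))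
    (h3 : a * Xa + b * Xb = (H + a) * q * (a ^ 2 + b ^ 2))
    (h4 : a * Ya + b * Yb = b * q * (a ^ 2 + b ^ 2)) :
    Xa = q * (H * a + a ^ 2 - b ^ 2) + 2 * n * b ^ 2 ∧
    Yb = -q * (H * a + a ^ 2 - b ^ 2) + 2 * n * a ^ 2 - 2 * n * H * a ∧
    Xb = q * b * (H + 2 * a) - 2 * n * a * b ∧
    Ya = q * b * (H + 2 * a) - 2 * n * a * b + 2 * H * n * b := by
  -- The Codazzi equations have Cauchy–Riemann form: they express `Ya`, `Yb` through `Xb`, `-Xa`.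
  -- What remains is a 2×2 system with determinant a² + b².
  have e1 : Xa = q * (H * a + a ^ 2 - b ^ 2) + 2 * n * b ^ 2 := by
    apply mul_left_cancel₀ hm
    linear_combination a * h3 - a * b * h1 + b ^ 2 * h2 - b * h4
  have e3 : Xb = q * b * (H + 2 * a) - 2 * n * a * b := by
    apply mul_left_cancel₀ hm
    linear_combination b * h3 + a ^ 2 * h1 - a * b * h2 + a * h4
  refine ⟨e1, ?_, e3, ?_⟩
  · linear_combination h2 - e1
  · linear_combination e3 - h1

variable {E : Type*} [NormedAddCommGroup E] [NormedSpace ℝ E]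

/-- A continuously differentiable function with values among the roots of a quadratic polynomial
has vanishing derivative. -/
theorem fderiv_eq_zero_of_quadratic {m : E → ℝ} {x : E} (hm : ContDiffAt ℝ 1 m x) {A B C : ℝ}
    (hA : A ≠ 0) (h : ∀ᶠ y in 𝓝 x, A * m y ^ 2 + B * m y + C = 0) : fderiv ℝ m x = 0 := by
  by_contra hne
  have hd : ∀ᶠ y in 𝓝 x, DifferentiableAt ℝ m y :=
    (hm.eventually (by simp)).mono fun y hy => hy.differentiableAt (by simp)
  have hc : ∀ᶠ y in 𝓝 x, fderiv ℝ m y ≠ 0 :=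
    (hm.continuousAt_fderiv (by simp)).eventually_ne hne
  -- Differentiating the polynomial identity gives (2Am + B) dm = 0. Where dm ≠ 0 this makes m
  -- locally constant, a contradiction.
  have h2 : ∀ᶠ y in 𝓝 x, m y = -B / (2 * A) := by
    filter_upwards [hd, hc, h.eventually_nhds] with y hy hy0 hyq
    have e1 : HasFDerivAt (fun z => A * m z ^ 2 + B * m z + C) _ y :=
      (((hy.hasFDerivAt.pow 2).const_mul A).add (hy.hasFDerivAt.const_mul B)).add_const C
    have e2 : HasFDerivAt (fun z => A * m z ^ 2 + B * m z + C) (0 : E →L[ℝ] ℝ) y :=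
      (hasFDerivAt_const (0 : ℝ) y).congr_of_eventuallyEq hyq
    have e3 := e1.unique e2
    have e4 : (2 * A * m y + B) • fderiv ℝ m y = 0 := by
      rw [← e3]
      ext w
      simp
      ring
    rcases smul_eq_zero.1 e4 with h5 | h5
    · field_simp
      linarith
    · exact absurd h5 hy0
  apply hne
  have : m =ᶠ[𝓝 x] fun _ => -B / (2 * A) := h2
  rw [this.fderiv_eq]
  simp

/-- The system satisfied, on a constant mean curvature translating soliton, by the angle function
`n` and the components `a`, `b` of the traceless part of the shape operator in a frame `X`, `Y`
made of the tangential part of the direction and of its rotation. -/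
structure SolitonSystem (U : Set E) (H k : ℝ) (n a b : E → ℝ) (X Y : E → E) : Prop where
  isOpen : IsOpen U
  smooth_n : ContDiffOn ℝ ∞ n U
  smooth_a : ContDiffOn ℝ ∞ a U
  smooth_b : ContDiffOn ℝ ∞ b U
  smooth_X : ContDiffOn ℝ ∞ X U
  smooth_Y : ContDiffOn ℝ ∞ Y U
  sq_ne : ∀ x ∈ U, 1 - n x ^ 2 ≠ 0
  norm_eq : ∀ x ∈ U, a x ^ 2 + b x ^ 2 = k - n x
  n_X : ∀ x ∈ U, fderiv ℝ n x (X x) = -(H + a x) * (1 - n x ^ 2)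
  n_Y : ∀ x ∈ U, fderiv ℝ n x (Y x) = -b x * (1 - n x ^ 2)
  bracket : ∀ x ∈ U, VectorField.lieBracket ℝ X Y x =
    (2 * n x * a x) • Y x - (2 * n x * b x) • X x
  codazzi_fst : ∀ x ∈ U, fderiv ℝ b x (X x) - fderiv ℝ a x (Y x) = -2 * H * n x * b x
  codazzi_snd : ∀ x ∈ U, fderiv ℝ a x (X x) + fderiv ℝ b x (Y x) =
    -2 * n x * (a x * H - (a x ^ 2 + b x ^ 2))

namespace SolitonSystem

variable {U : Set E} {H k : ℝ} {n a b : E → ℝ} {X Y : E → E}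

theorem fderiv_norm_eq (h : SolitonSystem U H k n a b X Y) {x : E} (hx : x ∈ U) (w : E) :
    2 * a x * fderiv ℝ a x w + 2 * b x * fderiv ℝ b x w = -fderiv ℝ n x w := by
  have hU := h.isOpen.mem_nhds hx
  have ha := ((h.smooth_a.contDiffAt hU).differentiableAt (by simp)).hasFDerivAt
  have hb := ((h.smooth_b.contDiffAt hU).differentiableAt (by simp)).hasFDerivAt
  have hn := ((h.smooth_n.contDiffAt hU).differentiableAt (by simp)).hasFDerivAt
  have e1 : HasFDerivAt (fun z => a z ^ 2 + b z ^ 2) _ x := (ha.pow 2).add (hb.pow 2)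
  have e2 : HasFDerivAt (fun z => a z ^ 2 + b z ^ 2) _ x :=
    (hn.const_sub k).congr_of_eventuallyEq (by
      filter_upwards [hU] with z hz using h.norm_eq z hz)
  have e3 := congrArg (fun L : E →L[ℝ] ℝ => L w) (e1.unique e2)
  simpa using e3

/-- The quotient of `1 - n ^ 2` by twice `a ^ 2 + b ^ 2`. -/
noncomputable def ratio (n a b : E → ℝ) (x : E) : ℝ := (1 - n x ^ 2) / (2 * (a x ^ 2 + b x ^ 2))

theorem ratio_mul {E : Type*} {n a b : E → ℝ} {x : E} (hm : a x ^ 2 + b x ^ 2 ≠ 0) :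
    1 - n x ^ 2 = 2 * ratio n a b x * (a x ^ 2 + b x ^ 2) := by
  unfold ratio
  field_simp

theorem contDiffAt_ratio (h : SolitonSystem U H k n a b X Y) {x : E} (hx : x ∈ U)
    (hm : a x ^ 2 + b x ^ 2 ≠ 0) : ContDiffAt ℝ ∞ (ratio n a b) x := by
  have hU := h.isOpen.mem_nhds hx
  have ha := h.smooth_a.contDiffAt hU
  have hb := h.smooth_b.contDiffAt hU
  have hn := h.smooth_n.contDiffAt hU
  unfold ratio
  exact (contDiffAt_const.sub (hn.pow 2)).div (contDiffAt_const.mul ((ha.pow 2).add (hb.pow 2)))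
    (mul_ne_zero two_ne_zero hm)

/-- Writing 1 - n² = 2qm, with q = `ratio n a b` and m = a² + b², lets m be cancelled, so that the
derivatives of a and b are polynomial in q, n, a, b and H. -/
theorem derivatives (h : SolitonSystem U H k n a b X Y) {x : E} (hx : x ∈ U)
    (hm : a x ^ 2 + b x ^ 2 ≠ 0) :
    fderiv ℝ a x (X x) = ratio n a b x * (H * a x + a x ^ 2 - b x ^ 2) + 2 * n x * b x ^ 2 ∧
    fderiv ℝ b x (Y x) = -ratio n a b x * (H * a x + a x ^ 2 - b x ^ 2) + 2 * n x * a x ^ 2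
      - 2 * n x * H * a x ∧
    fderiv ℝ b x (X x) = ratio n a b x * b x * (H + 2 * a x) - 2 * n x * a x * b x ∧
    fderiv ℝ a x (Y x) = ratio n a b x * b x * (H + 2 * a x) - 2 * n x * a x * b x
      + 2 * H * n x * b x := by
  refine codazzi_solve hm (h.codazzi_fst x hx) (h.codazzi_snd x hx) ?_ ?_
  · have := h.fderiv_norm_eq hx (X x)
    rw [h.n_X x hx, ratio_mul hm] at this
    linear_combination this / 2
  · have := h.fderiv_norm_eq hx (Y x)
    rw [h.n_Y x hx, ratio_mul hm] at this
    linear_combination this / 2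

theorem eventually_regular (h : SolitonSystem U H k n a b X Y) {x : E} (hx : x ∈ U)
    (hm : a x ^ 2 + b x ^ 2 ≠ 0) : ∀ᶠ y in 𝓝 x, y ∈ U ∧ a y ^ 2 + b y ^ 2 ≠ 0 := by
  have hU := h.isOpen.mem_nhds hx
  have ha := (h.smooth_a.contDiffAt hU).continuousAt
  have hb := (h.smooth_b.contDiffAt hU).continuousAt
  exact Filter.Eventually.and hU (((ha.pow 2).add (hb.pow 2)).eventually_ne hm)

/-- Obtained by differentiating 1 - n² = 2qm and cancelling m. With `derivatives`, it shows that
polynomials in q, n, a, b are closed under differentiation along X and Y. -/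
theorem fderiv_ratio (h : SolitonSystem U H k n a b X Y) {x : E} (hx : x ∈ U)
    (hm : a x ^ 2 + b x ^ 2 ≠ 0) :
    fderiv ℝ (ratio n a b) x (X x) = 2 * ratio n a b x * (H + a x) * (n x - ratio n a b x) ∧
    fderiv ℝ (ratio n a b) x (Y x) = 2 * ratio n a b x * b x * (n x - ratio n a b x) := by
  have hU := h.isOpen.mem_nhds hx
  have ha := ((h.smooth_a.contDiffAt hU).differentiableAt (by simp)).hasFDerivAt
  have hb := ((h.smooth_b.contDiffAt hU).differentiableAt (by simp)).hasFDerivAt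
  have hn := ((h.smooth_n.contDiffAt hU).differentiableAt (by simp)).hasFDerivAt
  have hq := ((h.contDiffAt_ratio hx hm).differentiableAt (by simp)).hasFDerivAt
  have e1 : HasFDerivAt (fun z => 2 * ratio n a b z * (a z ^ 2 + b z ^ 2)) _ x :=
    (hq.const_mul 2).mul ((ha.pow 2).add (hb.pow 2))
  have e2 : HasFDerivAt (fun z => 2 * ratio n a b z * (a z ^ 2 + b z ^ 2)) _ x :=
    ((hn.pow 2).const_sub 1).congr_of_eventuallyEq (by
      filter_upwards [h.eventually_regular hx hm] with z hz using (ratio_mul hz.2).symm)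
  have e3 : ∀ w, 2 * ratio n a b x * (2 * a x * fderiv ℝ a x w + 2 * b x * fderiv ℝ b x w)
      + (a x ^ 2 + b x ^ 2) * (2 * fderiv ℝ (ratio n a b) x w) = -(2 * n x * fderiv ℝ n x w) := by
    intro w
    have e4 := congrArg (fun L : E →L[ℝ] ℝ => L w) (e1.unique e2)
    simp at e4
    linear_combination e4
  constructor
  · have := e3 (X x)
    rw [h.fderiv_norm_eq hx, h.n_X x hx, ratio_mul hm] at this
    apply mul_left_cancel₀ hm
    linear_combination this / 2
  · have := e3 (Y x)
    rw [h.fderiv_norm_eq hx, h.n_Y x hx, ratio_mul hm] at this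
    apply mul_left_cancel₀ hm
    linear_combination this / 2

theorem commutator (h : SolitonSystem U H k n a b X Y) {x : E} (hx : x ∈ U) {f : E → ℝ}
    (hf : ContDiffAt ℝ ∞ f x) :
    fderiv ℝ (fun z => fderiv ℝ f z (Y z)) x (X x) - fderiv ℝ (fun z => fderiv ℝ f z (X z)) x (Y x)
      = 2 * n x * a x * fderiv ℝ f x (Y x) - 2 * n x * b x * fderiv ℝ f x (X x) := by
  have hU := h.isOpen.mem_nhds hx
  have hX := (h.smooth_X.contDiffAt hU).differentiableAt (by simp)
  have hY := (h.smooth_Y.contDiffAt hU).differentiableAt (by simp)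
  have := VectorField.fderiv_apply_lieBracket hf
    (by simpa using two_le_infty) hY hX
  rw [h.bracket x hx] at this
  simp at this
  linarith

/-- The integrability condition of the system. -/
theorem integrability (h : SolitonSystem U H k n a b X Y) {x : E} (hx : x ∈ U)
    (hm : a x ^ 2 + b x ^ 2 ≠ 0) :
    ratio n a b x * (H ^ 2 + (a x ^ 2 + b x ^ 2) + 2 * H * a x)
      - n x * (H ^ 2 + (a x ^ 2 + b x ^ 2))
      - 2 * ((a x ^ 2 + b x ^ 2) - H ^ 2) * (a x ^ 2 + b x ^ 2) = 0 := by
  have hU := h.isOpen.mem_nhds hx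
  have hac := h.smooth_a.contDiffAt hU
  have hbc := h.smooth_b.contDiffAt hU
  have ha := (hac.differentiableAt (by simp)).hasFDerivAt
  have hb := (hbc.differentiableAt (by simp)).hasFDerivAt
  have hn := ((h.smooth_n.contDiffAt hU).differentiableAt (by simp)).hasFDerivAt
  have hq := ((h.contDiffAt_ratio hx hm).differentiableAt (by simp)).hasFDerivAt
  have hreg := h.eventually_regular hx hm
  obtain ⟨eXa, eYb, eXb, eYa⟩ := h.derivatives hx hm
  obtain ⟨eXq, eYq⟩ := h.fderiv_ratio hx hm
  have eXn := h.n_X x hx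
  have eYn := h.n_Y x hx
  rw [ratio_mul hm] at eXn eYn
  have base : HasFDerivAt (fun z => H * a z + a z ^ 2 - b z ^ 2) _ x :=
    ((ha.const_mul H).add (ha.pow 2)).sub (hb.pow 2)
  have cross : HasFDerivAt
      (fun z => ratio n a b z * b z * (H + 2 * a z) - 2 * n z * a z * b z) _ x :=
    ((hq.mul hb).mul ((ha.const_mul 2).const_add H)).sub (((hn.const_mul 2).mul ha).mul hb)
  have d1 : HasFDerivAt (fun z => fderiv ℝ a z (X z)) _ x :=
    HasFDerivAt.congr_of_eventuallyEq
      ((hq.mul base).add ((hn.const_mul 2).mul (hb.pow 2)))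
      (hreg.mono fun z hz => (h.derivatives hz.1 hz.2).1)
  have d2 : HasFDerivAt (fun z => fderiv ℝ b z (Y z)) _ x :=
    HasFDerivAt.congr_of_eventuallyEq
      (((hq.neg.mul base).add ((hn.const_mul 2).mul (ha.pow 2))).sub
        (((hn.const_mul 2).mul_const H).mul ha))
      (hreg.mono fun z hz => (h.derivatives hz.1 hz.2).2.1)
  have d3 : HasFDerivAt (fun z => fderiv ℝ b z (X z)) _ x :=
    cross.congr_of_eventuallyEq (hreg.mono fun z hz => (h.derivatives hz.1 hz.2).2.2.1)
  have d4 : HasFDerivAt (fun z => fderiv ℝ a z (Y z)) _ x :=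
    HasFDerivAt.congr_of_eventuallyEq (cross.add ((hn.const_mul (2 * H)).mul hb))
      (hreg.mono fun z hz => (h.derivatives hz.1 hz.2).2.2.2)
  have ca := h.commutator hx hac
  have cb := h.commutator hx hbc
  rw [d1.fderiv, d4.fderiv] at ca
  rw [d2.fderiv, d3.fderiv] at cb
  simp [eXa, eYb, eXb, eYa, eXq, eYq, eXn, eYn] at ca cb
  have hq0 : ratio n a b x ≠ 0 := by
    intro h0
    have := ratio_mul (n := n) hm
    rw [h0] at this
    exact h.sq_ne x hx (by simpa using this)
  generalize ratio n a b x = q at *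
  -- The commutator identities for a and b, combined with weights -b and a, give 2qm times the
  -- claim.
  apply mul_left_cancel₀ (mul_ne_zero (mul_ne_zero two_ne_zero hq0) hm)
  rw [mul_zero]
  linear_combination - b x * ca + a x * cb

/-- The Y-derivative of the integrability relation carries the factor b. Once it is divided out, a
and q disappear and a quadratic equation for n remains. -/
theorem fderiv_eq_zero_of_component_ne (h : SolitonSystem U H k n a b X Y) {x : E} (hx : x ∈ U)
    (hm : a x ^ 2 + b x ^ 2 ≠ 0) (hbx : b x ≠ 0) : fderiv ℝ n x = 0 := by
  have key : ∀ y ∈ U, a y ^ 2 + b y ^ 2 ≠ 0 → b y ≠ 0 →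
      (k - n y) ^ 2 = H ^ 2 * k := by
    intro y hy hmy hby
    have hU := h.isOpen.mem_nhds hy
    have ha := ((h.smooth_a.contDiffAt hU).differentiableAt (by simp)).hasFDerivAt
    have hb := ((h.smooth_b.contDiffAt hU).differentiableAt (by simp)).hasFDerivAt
    have hn := ((h.smooth_n.contDiffAt hU).differentiableAt (by simp)).hasFDerivAt
    have hq := ((h.contDiffAt_ratio hy hmy).differentiableAt (by simp)).hasFDerivAt
    obtain ⟨eXa, eYb, eXb, eYa⟩ := h.derivatives hy hmy
    obtain ⟨eXq, eYq⟩ := h.fderiv_ratio hy hmy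
    have eYn := h.n_Y y hy
    rw [ratio_mul hmy] at eYn
    have nm : HasFDerivAt (fun z => a z ^ 2 + b z ^ 2) _ y := (ha.pow 2).add (hb.pow 2)
    have d1 : HasFDerivAt (fun z => ratio n a b z * (H ^ 2 + (a z ^ 2 + b z ^ 2) + 2 * H * a z)
        - n z * (H ^ 2 + (a z ^ 2 + b z ^ 2))
        - 2 * ((a z ^ 2 + b z ^ 2) - H ^ 2) * (a z ^ 2 + b z ^ 2)) _ y :=
      ((hq.mul ((nm.const_add (H ^ 2)).add (ha.const_mul (2 * H)))).sub
        (hn.mul (nm.const_add (H ^ 2)))).sub (((nm.sub_const (H ^ 2)).const_mul 2).mul nm)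
    have d2 := d1.unique ((hasFDerivAt_const (0 : ℝ) y).congr_of_eventuallyEq
      ((h.eventually_regular hy hmy).mono fun z hz => h.integrability hz.1 hz.2))
    have d3 := congrArg (fun L : E →L[ℝ] ℝ => L (Y y)) d2
    simp [eYb, eYa, eYq, eYn] at d3
    have hq0 : ratio n a b y ≠ 0 := by
      intro h0
      have := ratio_mul (n := n) hmy
      rw [h0] at this
      exact h.sq_ne y hy (by simpa using this)
    have hk := h.norm_eq y hy
    have hnk : n y = k - (a y ^ 2 + b y ^ 2) := by linarith
    rw [← hk]
    rw [hnk] at d3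
    generalize ratio n a b y = q at *
    -- After n = k - m is inserted, the derivative reduces to 6qb(H²k - m²).
    apply mul_left_cancel₀ (mul_ne_zero hq0 hby)
    linear_combination -d3 / 6
  have hU := h.isOpen.mem_nhds hx
  refine fderiv_eq_zero_of_quadratic (A := 1) (B := -2 * k) (C := k ^ 2 - H ^ 2 * k)
    ((h.smooth_n.contDiffAt hU).of_le (by simp)) one_ne_zero ?_
  filter_upwards [h.eventually_regular hx hm,
    (h.smooth_b.contDiffAt hU).continuousAt.eventually_ne hbx] with y hy hby
  linear_combination key y hy.1 hy.2 hby

/-- Here the Y-derivative of the relation is empty, but the formula for the Y-derivative of b, now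
zero, gives q(H + a) = 2n(a - H). This eliminates q from the integrability relation. -/
theorem fderiv_eq_zero_of_component_eventually_zero (h : SolitonSystem U H k n a b X Y) {x : E}
    (hx : x ∈ U) (hm : a x ^ 2 + b x ^ 2 ≠ 0) (hbx : ∀ᶠ y in 𝓝 x, b y = 0) :
    fderiv ℝ n x = 0 := by
  have hU := h.isOpen.mem_nhds hx
  -- The coefficients expand 3m² - (k + 5H²)m + 3H²k with m = a² = k - n.
  refine fderiv_eq_zero_of_quadratic (A := 3) (B := -(6 * k) + (k + 5 * H ^ 2))
    (C := 3 * k ^ 2 - (k + 5 * H ^ 2) * k + 3 * H ^ 2 * k)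
    ((h.smooth_n.contDiffAt hU).of_le (by simp)) three_ne_zero ?_
  filter_upwards [h.eventually_regular hx hm, hbx.eventually_nhds] with y hy hby
  have hb0 : b y = 0 := hby.self_of_nhds
  have hdb : fderiv ℝ b y = 0 := by
    have : b =ᶠ[𝓝 y] fun _ => (0 : ℝ) := hby
    rw [this.fderiv_eq]
    simp
  have e1 := (h.derivatives hy.1 hy.2).2.1
  have e2 := h.integrability hy.1 hy.2
  have e3 := h.norm_eq y hy.1
  have hmy := hy.2
  rw [hdb] at e1
  simp only [hb0] at e1 e2 e3 hmy
  have ha0 : a y ≠ 0 := by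
    intro h0
    simp [h0] at hmy
  have e4 : ratio n a b y * (H + a y) = 2 * n y * (a y - H) := by
    apply mul_left_cancel₀ ha0
    simp at e1
    linear_combination e1
  have hnk : n y = k - a y ^ 2 := by linarith
  rw [hnk] at e2 e4 ⊢
  linear_combination -e2 + (H + a y) * e4

/-- The angle function has no nonzero derivative. -/
theorem fderiv_eq_zero (h : SolitonSystem U H k n a b X Y) {x : E} (hx : x ∈ U) :
    fderiv ℝ n x = 0 := by
  by_cases hm : a x ^ 2 + b x ^ 2 = 0
  · have ha0 : a x = 0 := by nlinarith [sq_nonneg (a x), sq_nonneg (b x)]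
    have hb0 : b x = 0 := by nlinarith [sq_nonneg (a x), sq_nonneg (b x)]
    ext w
    have := h.fderiv_norm_eq hx w
    rw [ha0, hb0] at this
    simp at this
    simpa using this
  -- If dn ≠ 0 at x, then also nearby, so the case b ≠ 0 is excluded on a whole neighbourhood. This
  -- is the hypothesis of the case b = 0.
  by_contra hne
  have hc : ∀ᶠ y in 𝓝 x, fderiv ℝ n y ≠ 0 :=
    ((h.smooth_n.contDiffAt (h.isOpen.mem_nhds hx)).continuousAt_fderiv (by simp)).eventually_ne hne
  refine hne (h.fderiv_eq_zero_of_component_eventually_zero hx hm ?_)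
  filter_upwards [hc, h.eventually_regular hx hm] with y hy hyr
  by_contra hb
  exact hy (h.fderiv_eq_zero_of_component_ne hyr.1 hyr.2 hb)

/-- Either the angle function or the mean curvature vanishes. -/
theorem eq_zero_or_eq_zero (h : SolitonSystem U H k n a b X Y) {x : E} (hx : x ∈ U) :
    n x = 0 ∨ H = 0 := by
  have hab : ∀ y ∈ U, a y = -H ∧ b y = 0 := by
    intro y hy
    have e1 := h.n_X y hy
    have e2 := h.n_Y y hy
    rw [h.fderiv_eq_zero hy] at e1 e2
    simp [h.sq_ne y hy] at e1 e2
    exact ⟨by linarith, e2⟩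
  have hU := h.isOpen.mem_nhds hx
  have hda : fderiv ℝ a x = 0 := by
    have : a =ᶠ[𝓝 x] fun _ => -H := by filter_upwards [hU] with y hy using (hab y hy).1
    rw [this.fderiv_eq]
    simp
  have hdb : fderiv ℝ b x = 0 := by
    have : b =ᶠ[𝓝 x] fun _ => (0 : ℝ) := by filter_upwards [hU] with y hy using (hab y hy).2
    rw [this.fderiv_eq]
    simp
  -- With a = -H and b = 0 constant, this equation reads 0 = 4nH².
  have := h.codazzi_snd x hx
  rw [hda, hdb, (hab x hx).1, (hab x hx).2] at this
  have h3 : n x * H ^ 2 = 0 := by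
    simp at this
    rcases this with h | h
    · simp [h]
    · have : H = 0 := by nlinarith
      simp [this]
  simpa using h3

end SolitonSystem

end ScalarSystem

/-! ### Linear algebra: cross product, planar frames -/

section LinearAlgebra

/-- For a unit vector `v` there is a skew map whose square is minus the projection onto the plane
orthogonal to `v`, namely the cross product with `v`. -/
theorem exists_skew_map {v : E3} (hv : ‖v‖ = 1) :
    ∃ L : E3 →L[ℝ] E3, (∀ x y, ⟪L x, y⟫_ℝ = -⟪x, L y⟫_ℝ) ∧ ∀ x, L (L x) = ⟪x, v⟫_ℝ • v - x := by
  let A : E3 →ₗ[ℝ] E3 :=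
    { toFun := fun x => !₂[x 1 * v 2 - x 2 * v 1, x 2 * v 0 - x 0 * v 2, x 0 * v 1 - x 1 * v 0]
      map_add' := fun x y => by ext i; fin_cases i <;> simp <;> ring
      map_smul' := fun c x => by ext i; fin_cases i <;> simp <;> ring }
  have hA : ∀ x, A x =
      !₂[x 1 * v 2 - x 2 * v 1, x 2 * v 0 - x 0 * v 2, x 0 * v 1 - x 1 * v 0] := fun x => rfl
  have hv2 : v 0 ^ 2 + v 1 ^ 2 + v 2 ^ 2 = 1 := by
    have := EuclideanSpace.norm_sq_eq v
    rw [hv, Fin.sum_univ_three] at this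
    simpa using this.symm
  refine ⟨LinearMap.toContinuousLinearMap A, fun x y => ?_, fun x => ?_⟩
  · simp [PiLp.inner_apply, Fin.sum_univ_three, hA]
    ring
  · ext i
    fin_cases i <;> simp [PiLp.inner_apply, Fin.sum_univ_three, hA]
    · linear_combination (-x 0) * hv2
    · linear_combination (-x 1) * hv2
    · linear_combination (-x 2) * hv2

/-- Trace and determinant of an endomorphism of a plane, read off in a basis. -/
theorem trace_det_of_frame {V : Type*} [AddCommGroup V] [Module ℝ V]
    (hV : Module.finrank ℝ V = 2) (S : V →ₗ[ℝ] V) {X Y : V} (hXY : LinearIndependent ℝ ![X, Y])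
    {p q r t : ℝ} (hX : S X = p • X + q • Y) (hY : S Y = r • X + t • Y) :
    LinearMap.trace ℝ V S = p + t ∧ LinearMap.det S = p * t - q * r := by
  let e := basisOfLinearIndependentOfCardEqFinrank hXY (by simp [hV])
  have e0 : e 0 = X := by simp [e]
  have e1 : e 1 = Y := by simp [e]
  have hM : LinearMap.toMatrix e e S = !![p, r; q, t] := by
    ext i j
    rw [LinearMap.toMatrix_apply]
    fin_cases j
    · simp only [Fin.zero_eta, e0, hX]
      rw [← e0, ← e1]
      fin_cases i <;> simp
    · simp only [Fin.mk_one, e1, hY]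
      rw [← e0, ← e1]
      fin_cases i <;> simp
  constructor
  · rw [LinearMap.trace_eq_matrix_trace ℝ e, hM, Matrix.trace_fin_two]
    simp
  · rw [← LinearMap.det_toMatrix e, hM, Matrix.det_fin_two]
    simp
    ring

theorem exists_coordinates {V : Type*} [AddCommGroup V] [Module ℝ V]
    (hV : Module.finrank ℝ V = 2) {X Y : V} (hXY : LinearIndependent ℝ ![X, Y]) (Z : V) :
    ∃ p q : ℝ, Z = p • X + q • Y := by
  let e := basisOfLinearIndependentOfCardEqFinrank hXY (by simp [hV])
  refine ⟨e.repr Z 0, e.repr Z 1, ?_⟩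
  have := e.sum_repr Z
  rw [Fin.sum_univ_two] at this
  simpa [e] using this.symm

/-- Preimages of orthogonal nonzero vectors are linearly independent. -/
theorem linearIndependent_pair_of_orthogonal {V F : Type*} [AddCommGroup V] [Module ℝ V]
    [NormedAddCommGroup F] [InnerProductSpace ℝ F] (A : V →ₗ[ℝ] F) {X Y : V}
    (h : ⟪A X, A Y⟫_ℝ = 0) (hX : A X ≠ 0) (hY : A Y ≠ 0) :
    LinearIndependent ℝ ![X, Y] := by
  rw [LinearIndependent.pair_iff]
  intro s t hst
  have h0 : s • A X + t • A Y = 0 := by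
    rw [← map_smul, ← map_smul, ← map_add, hst, map_zero]
  constructor
  · have := congrArg (fun w => ⟪w, A X⟫_ℝ) h0
    simp only [inner_add_left, inner_smul_left, inner_zero_left] at this
    rw [real_inner_comm] at h
    simpa [h, hX, real_inner_comm] using this
  · have := congrArg (fun w => ⟪w, A Y⟫_ℝ) h0
    simp only [inner_add_left, inner_smul_left, inner_zero_left] at this
    simpa [h, hY, real_inner_comm] using this

end LinearAlgebra

/-! ### Lifting tangent fields along an immersion -/

section LiftOfTangentFields

/-- Coordinate space of a surface. -/
abbrev E2 : Type := EuclideanSpace ℝ (Fin 2)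

/-- A smooth tangent field along an immersion is the image of a smooth vector field. -/
theorem exists_vectorField {U : Set E2} (hU : IsOpen U) {φ ν F : E2 → E3}
    (hφ : ContDiffOn ℝ ∞ φ U) (hν : ContDiffOn ℝ ∞ ν U) (hF : ContDiffOn ℝ ∞ F U)
    (hinj : ∀ x ∈ U, Function.Injective (fderiv ℝ φ x)) (hnorm : ∀ x ∈ U, ‖ν x‖ = 1)
    (horth : ∀ x ∈ U, ∀ Z, ⟪ν x, fderiv ℝ φ x Z⟫_ℝ = 0) (hFν : ∀ x ∈ U, ⟪ν x, F x⟫_ℝ = 0) :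
    ∃ X : E2 → E2, ContDiffOn ℝ ∞ X U ∧ ∀ x ∈ U, fderiv ℝ φ x (X x) = F x := by
  -- Bordering dφ by the normal gives an invertible operator, whose inverse depends smoothly on the
  -- point. X is the first component of the preimage of F; the second vanishes because F is
  -- tangential.
  let B : E2 → (E2 × ℝ →L[ℝ] E3) := fun x =>
    (fderiv ℝ φ x).comp (ContinuousLinearMap.fst ℝ E2 ℝ)
      + (ContinuousLinearMap.snd ℝ E2 ℝ).smulRight (ν x)
  have hB : ∀ x Z t, B x (Z, t) = fderiv ℝ φ x Z + t • ν x := fun x Z t => by simp [B]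
  have hBt : ∀ x ∈ U, ∀ Z t, ⟪ν x, B x (Z, t)⟫_ℝ = t := fun x hx Z t => by
    rw [hB, inner_add_right, horth x hx, inner_smul_right, real_inner_self_eq_norm_sq, hnorm x hx]
    simp
  have hBinj : ∀ x ∈ U, Function.Injective (B x) := by
    intro x hx
    rw [injective_iff_map_eq_zero]
    rintro ⟨Z, t⟩ h0
    have ht := hBt x hx Z t
    rw [h0, inner_zero_right] at ht
    subst ht
    rw [hB, zero_smul, add_zero] at h0
    have : Z = 0 := hinj x hx (by rw [h0, map_zero])
    simp [this]
  have hBe : ∀ x ∈ U, ∃ e : (E2 × ℝ) ≃L[ℝ] E3, (e : E2 × ℝ →L[ℝ] E3) = B x := by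
    intro x hx
    let e := LinearEquiv.ofInjectiveOfFinrankEq (B x : E2 × ℝ →ₗ[ℝ] E3) (hBinj x hx) (by simp)
    exact ⟨e.toContinuousLinearEquiv, ContinuousLinearMap.ext fun z => rfl⟩
  refine ⟨fun x => ((B x).inverse (F x)).1, fun x hx => ContDiffAt.contDiffWithinAt ?_,
    fun x hx => ?_⟩
  · have hUx := hU.mem_nhds hx
    have hBs : ContDiffAt ℝ ∞ B x := by
      have h1 : ContDiffAt ℝ ∞ (fderiv ℝ φ) x :=
        (hφ.contDiffAt hUx).fderiv_right (m := ∞) (by simp)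
      exact (h1.clm_comp contDiffAt_const).add
        (ContDiffAt.smulRight contDiffAt_const (hν.contDiffAt hUx))
    obtain ⟨e, he⟩ := hBe x hx
    have hinv : ContDiffAt ℝ ∞ (fun y => (B y).inverse) x := by
      have := contDiffAt_map_inverse (n := ∞) e
      rw [he] at this
      exact this.comp x hBs
    exact contDiffAt_fst.comp x (hinv.clm_apply (hF.contDiffAt hUx))
  · obtain ⟨e, he⟩ := hBe x hx
    have h1 : B x ((B x).inverse (F x)) = F x := by
      rw [← he]
      simp
    have h2 := hBt x hx ((B x).inverse (F x)).1 ((B x).inverse (F x)).2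
    rw [Prod.mk.eta, h1, hFν x hx] at h2
    have h3 := hB x ((B x).inverse (F x)).1 ((B x).inverse (F x)).2
    rw [Prod.mk.eta, h1, ← h2, zero_smul, add_zero] at h3
    exact h3.symm

end LiftOfTangentFields

/-! ### Structure equations of a parametrized soliton -/

section LocalSoliton

/-- A parametrized surface `φ` with unit normal `ν` whose mean curvature is the constant `H` and
whose Gauss curvature is `⟪ν, v⟫ + l`. -/
structure LocalSoliton (U : Set E2) (φ ν : E2 → E3) (v : E3) (H l : ℝ) : Prop where
  isOpen : IsOpen U
  smooth : ContDiffOn ℝ ∞ φ U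
  smooth_normal : ContDiffOn ℝ ∞ ν U
  injective : ∀ x ∈ U, Function.Injective (fderiv ℝ φ x)
  norm_normal : ∀ x ∈ U, ‖ν x‖ = 1
  orthogonal : ∀ x ∈ U, ∀ Z, ⟪ν x, fderiv ℝ φ x Z⟫_ℝ = 0
  shape : ∀ x ∈ U, ∃ S : E2 →ₗ[ℝ] E2, (∀ Z, fderiv ℝ φ x (S Z) = -fderiv ℝ ν x Z) ∧
    LinearMap.trace ℝ E2 S = 2 * H ∧ LinearMap.det S = ⟪ν x, v⟫_ℝ + l

namespace LocalSoliton

variable {U : Set E2} {φ ν : E2 → E3} {v : E3} {H l : ℝ}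

/-- The second fundamental form is symmetric. -/
theorem symmetric (h : LocalSoliton U φ ν v H l) {x : E2} (hx : x ∈ U) (Z Z' : E2) :
    ⟪fderiv ℝ ν x Z, fderiv ℝ φ x Z'⟫_ℝ = ⟪fderiv ℝ ν x Z', fderiv ℝ φ x Z⟫_ℝ := by
  have hU := h.isOpen.mem_nhds hx
  have hφ := h.smooth.contDiffAt hU
  have hν := ((h.smooth_normal.contDiffAt hU).differentiableAt (by simp)).hasFDerivAt
  have hdφ : HasFDerivAt (fderiv ℝ φ) (fderiv ℝ (fderiv ℝ φ) x) x :=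
    ((hφ.fderiv_right (m := 1) (by rw [one_add_one_eq_two]; exact two_le_infty)).differentiableAt
      (by simp)).hasFDerivAt
  have hsymm : IsSymmSndFDerivAt ℝ φ x :=
    hφ.isSymmSndFDerivAt (by simpa using two_le_infty)
  -- Differentiate ⟨ν, dφ(B)⟩ = 0 in the direction A. Symmetry of the second derivative of φ then
  -- gives the claim.
  have key : ∀ A B, ⟪ν x, fderiv ℝ (fderiv ℝ φ) x A B⟫_ℝ = -⟪fderiv ℝ ν x A, fderiv ℝ φ x B⟫_ℝ := by
    intro A B
    have e1 : HasFDerivAt (fun z => ⟪ν z, fderiv ℝ φ z B⟫_ℝ) _ x :=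
      hν.inner ℝ (hdφ.clm_apply (hasFDerivAt_const B x))
    have e2 : HasFDerivAt (fun z => ⟪ν z, fderiv ℝ φ z B⟫_ℝ) (0 : E2 →L[ℝ] ℝ) x :=
      (hasFDerivAt_const (0 : ℝ) x).congr_of_eventuallyEq (by
        filter_upwards [hU] with z hz using h.orthogonal z hz B)
    have e3 := congrArg (fun L : E2 →L[ℝ] ℝ => L A) (e1.unique e2)
    simp at e3
    linarith
  have := key Z Z'
  rw [hsymm Z Z', key Z' Z] at this
  linarith

/-- In the frame of tangent fields that lift the tangential part of `v` and its rotation, the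
structure equations of the surface form a soliton system. -/
theorem exists_solitonSystem (h : LocalSoliton U φ ν v H l) (hv : ‖v‖ = 1) :
    ∃ (a b : E2 → ℝ) (X Y : E2 → E2),
      SolitonSystem {x | x ∈ U ∧ 1 - ⟪ν x, v⟫_ℝ ^ 2 ≠ 0} H (H ^ 2 - l) (fun x => ⟪ν x, v⟫_ℝ)
        a b X Y := by
  obtain ⟨L, hL, hLL⟩ := exists_skew_map hv
  have hvv : ⟪v, v⟫_ℝ = 1 := by rw [real_inner_self_eq_norm_sq, hv]; norm_num
  have hLs : ∀ x, ⟪x, L x⟫_ℝ = 0 := fun x => by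
    have := hL x x
    rw [real_inner_comm] at this
    linarith
  have hLv : L v = 0 := by
    rw [← inner_self_eq_zero (𝕜 := ℝ), hL, hLL, hvv]
    simp
  have hLsv : ∀ x, ⟪L x, v⟫_ℝ = 0 := fun x => by rw [hL, hLv, inner_zero_right, neg_zero]
  set n : E2 → ℝ := fun x => ⟪ν x, v⟫_ℝ with hn
  set V : Set E2 := {x | x ∈ U ∧ 1 - n x ^ 2 ≠ 0}
  -- T is the tangential part of v and W = ν × v its rotation. They are orthogonal, both with
  -- squared length 1 - n².
  set T : E2 → E3 := fun x => v - n x • ν x with hT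
  set W : E2 → E3 := fun x => L (ν x) with hW
  have hnU : ContDiffOn ℝ ∞ n U := h.smooth_normal.inner ℝ contDiffOn_const
  have hTU : ContDiffOn ℝ ∞ T U := contDiffOn_const.sub (hnU.smul h.smooth_normal)
  have hWU : ContDiffOn ℝ ∞ W U := L.contDiff.comp_contDiffOn h.smooth_normal
  have hνν : ∀ x ∈ U, ⟪ν x, ν x⟫_ℝ = 1 := fun x hx => by
    rw [real_inner_self_eq_norm_sq, h.norm_normal x hx]; norm_num
  have hνT : ∀ x ∈ U, ⟪ν x, T x⟫_ℝ = 0 := fun x hx => by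
    simp only [hT, inner_sub_right, inner_smul_right, hνν x hx, hn]
    ring
  have hνW : ∀ x ∈ U, ⟪ν x, W x⟫_ℝ = 0 := fun x hx => hLs _
  have hTv : ∀ x, ⟪T x, v⟫_ℝ = 1 - n x ^ 2 := fun x => by
    simp only [hT, inner_sub_left, inner_smul_left, hvv, hn]
    simp
    ring
  have hTT : ∀ x ∈ U, ⟪T x, T x⟫_ℝ = 1 - n x ^ 2 := fun x hx => by
    have : ⟪T x, T x⟫_ℝ = ⟪T x, v⟫_ℝ - n x * ⟪ν x, T x⟫_ℝ := by
      conv_lhs => rw [show ⟪T x, T x⟫_ℝ = ⟪T x, v - n x • ν x⟫_ℝ from rfl]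
      rw [inner_sub_right, inner_smul_right, real_inner_comm (ν x)]
    rw [this, hTv, hνT x hx, mul_zero, sub_zero]
  have hWv : ∀ x, ⟪W x, v⟫_ℝ = 0 := fun x => hLsv _
  have hWW : ∀ x ∈ U, ⟪W x, W x⟫_ℝ = 1 - n x ^ 2 := fun x hx => by
    simp only [hW, hL, hLL, inner_sub_right, inner_smul_right, hνν x hx, hn]
    ring
  have hTW : ∀ x ∈ U, ⟪T x, W x⟫_ℝ = 0 := fun x hx => by
    simp only [hT, inner_sub_left, inner_smul_left, hνW x hx]
    rw [real_inner_comm, hWv]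
    simp
  have hLT : ∀ x, L (T x) = -n x • W x := fun x => by
    simp only [hT, hW, map_sub, map_smul, hLv]
    module
  have hLW : ∀ x, L (W x) = n x • T x - (1 - n x ^ 2) • ν x := fun x => by
    simp only [hT, hW, hLL]
    module
  obtain ⟨X, hXs, hX⟩ := exists_vectorField h.isOpen h.smooth h.smooth_normal hTU h.injective
    h.norm_normal h.orthogonal hνT
  obtain ⟨Y, hYs, hY⟩ := exists_vectorField h.isOpen h.smooth h.smooth_normal hWU h.injective
    h.norm_normal h.orthogonal hνW
  have hind : ∀ x ∈ U, 1 - n x ^ 2 ≠ 0 → LinearIndependent ℝ ![X x, Y x] := by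
    intro x hx hs
    refine linearIndependent_pair_of_orthogonal (fderiv ℝ φ x : E2 →ₗ[ℝ] E3) ?_ ?_ ?_
    · change ⟪fderiv ℝ φ x (X x), fderiv ℝ φ x (Y x)⟫_ℝ = 0
      rw [hX x hx, hY x hx, hTW x hx]
    · change fderiv ℝ φ x (X x) ≠ 0
      rw [hX x hx, ← inner_self_ne_zero (𝕜 := ℝ), hTT x hx]
      exact hs
    · change fderiv ℝ φ x (Y x) ≠ 0
      rw [hY x hx, ← inner_self_ne_zero (𝕜 := ℝ), hWW x hx]
      exact hs
  have hVU : ∀ x ∈ V, x ∈ U := fun x hx => hx.1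
  have hVo : IsOpen V := by
    have : ContinuousOn (fun x => 1 - n x ^ 2) U :=
      continuousOn_const.sub (hnU.continuousOn.pow 2)
    exact this.isOpen_inter_preimage h.isOpen isOpen_compl_singleton
  have hdn : ∀ x ∈ U, ∀ Z, fderiv ℝ n x Z = ⟪fderiv ℝ ν x Z, v⟫_ℝ := by
    intro x hx Z
    have hν := ((h.smooth_normal.contDiffAt (h.isOpen.mem_nhds hx)).differentiableAt
      (by simp)).hasFDerivAt
    have e1 : HasFDerivAt n _ x := hν.inner ℝ (hasFDerivAt_const v x)
    rw [e1.fderiv]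
    simp
  -- Since v is orthogonal to W and ⟨T, v⟩ = 1 - n², the entries of S can be read off from dn.
  -- Defined in this way they are visibly smooth.
  set a : E2 → ℝ := fun x => -fderiv ℝ n x (X x) / (1 - n x ^ 2) - H with ha
  set b : E2 → ℝ := fun x => -fderiv ℝ n x (Y x) / (1 - n x ^ 2) with hb
  have hdnU : ContDiffOn ℝ ∞ (fderiv ℝ n) U := hnU.fderiv_of_isOpen h.isOpen (by simp)
  have hsV : ContDiffOn ℝ ∞ (fun x => 1 - n x ^ 2) V :=
    (contDiffOn_const.sub (hnU.pow 2)).mono hVU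
  have haV : ContDiffOn ℝ ∞ a V :=
    (((hdnU.clm_apply hXs).neg.mono hVU).div hsV fun x hx => hx.2).sub contDiffOn_const
  have hbV : ContDiffOn ℝ ∞ b V :=
    ((hdnU.clm_apply hYs).neg.mono hVU).div hsV fun x hx => hx.2
  have hshape : ∀ x ∈ V, fderiv ℝ ν x (X x) = -((H + a x) • T x + b x • W x) ∧
      fderiv ℝ ν x (Y x) = -(b x • T x + (H - a x) • W x) ∧
      a x ^ 2 + b x ^ 2 = H ^ 2 - l - n x := by
    intro x hx
    obtain ⟨hxU, hs⟩ := hx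
    obtain ⟨S, hS, htr, hdet⟩ := h.shape x hxU
    have hfr : Module.finrank ℝ E2 = 2 := by simp
    obtain ⟨p, q, hpq⟩ := exists_coordinates hfr (hind x hxU hs) (S (X x))
    obtain ⟨r, t, hrt⟩ := exists_coordinates hfr (hind x hxU hs) (S (Y x))
    obtain ⟨h1, h2⟩ := trace_det_of_frame hfr S (hind x hxU hs) hpq hrt
    have e1 : fderiv ℝ ν x (X x) = -(p • T x + q • W x) := by
      have := hS (X x)
      rw [hpq, map_add, map_smul, map_smul, hX x hxU, hY x hxU] at this
      rw [this, neg_neg]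
    have e2 : fderiv ℝ ν x (Y x) = -(r • T x + t • W x) := by
      have := hS (Y x)
      rw [hrt, map_add, map_smul, map_smul, hX x hxU, hY x hxU] at this
      rw [this, neg_neg]
    -- Symmetry of the second fundamental form suffices because the frame vectors are orthogonal and
    -- of equal length.
    have hqr : q = r := by
      have := h.symmetric hxU (X x) (Y x)
      rw [e1, e2, hX x hxU, hY x hxU] at this
      simp only [inner_neg_left, inner_add_left, inner_smul_left, hTW x hxU, hTT x hxU,
        hWW x hxU, real_inner_comm (T x) (W x)] at this
      simp at this
      rcases this with h | h
      · exact h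
      · exact absurd h hs
    have ea : p = H + a x := by
      simp only [ha, hdn x hxU, e1, inner_neg_left, inner_add_left, inner_smul_left, hTv, hWv]
      field_simp
      simp
    have eb : r = b x := by
      simp only [hb, hdn x hxU, e2, inner_neg_left, inner_add_left, inner_smul_left, hTv, hWv]
      field_simp
      simp
    have et : t = H - a x := by linarith
    refine ⟨by rw [e1, ea, hqr, eb], by rw [e2, eb, et], ?_⟩
    rw [hdet, hqr, ea, eb, et] at h2
    change n x + l = _ at h2
    linear_combination h2
  have hTd : ∀ x ∈ U, ∀ Z, fderiv ℝ T x Z = -fderiv ℝ n x Z • ν x - n x • fderiv ℝ ν x Z := by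
    intro x hx Z
    have hν := ((h.smooth_normal.contDiffAt (h.isOpen.mem_nhds hx)).differentiableAt
      (by simp)).hasFDerivAt
    have hnx := ((hnU.contDiffAt (h.isOpen.mem_nhds hx)).differentiableAt (by simp)).hasFDerivAt
    have e1 : HasFDerivAt T _ x := (hnx.smul hν).const_sub v
    rw [e1.fderiv]
    simp
    module
  have hWd : ∀ x ∈ U, ∀ Z, fderiv ℝ W x Z = L (fderiv ℝ ν x Z) := by
    intro x hx Z
    have hν := ((h.smooth_normal.contDiffAt (h.isOpen.mem_nhds hx)).differentiableAt
      (by simp)).hasFDerivAt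
    have e1 : HasFDerivAt W _ x := L.hasFDerivAt.comp x hν
    rw [e1.fderiv]
    simp
  have hnX : ∀ x ∈ V, fderiv ℝ n x (X x) = -(H + a x) * (1 - n x ^ 2) := by
    intro x hx
    have := hx.2
    simp only [ha]
    field_simp
    ring
  have hnY : ∀ x ∈ V, fderiv ℝ n x (Y x) = -b x * (1 - n x ^ 2) := by
    intro x hx
    have := hx.2
    simp only [hb]
    field_simp
  have hbr : ∀ x ∈ V, VectorField.lieBracket ℝ X Y x =
      (2 * n x * a x) • Y x - (2 * n x * b x) • X x := by
    intro x hx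
    have hxU := hx.1
    have hU := h.isOpen.mem_nhds hxU
    -- dφ[X, Y] is the X-derivative of W minus the Y-derivative of T; injectivity of dφ recovers the
    -- bracket.
    have e1 := VectorField.fderiv_apply_lieBracket (h.smooth.contDiffAt hU)
      (by simpa using two_le_infty)
      ((hYs.contDiffAt hU).differentiableAt (by simp))
      ((hXs.contDiffAt hU).differentiableAt (by simp))
    have eY : (fun x => fderiv ℝ φ x (Y x)) =ᶠ[𝓝 x] W := by
      filter_upwards [hU] with z hz using hY z hz
    have eX : (fun x => fderiv ℝ φ x (X x)) =ᶠ[𝓝 x] T := by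
      filter_upwards [hU] with z hz using hX z hz
    rw [eY.fderiv_eq, eX.fderiv_eq, hTd x hxU, hWd x hxU, hnY x hx, (hshape x hx).1,
      (hshape x hx).2.1] at e1
    apply h.injective x hxU
    rw [e1]
    simp only [map_neg, map_add, map_sub, map_smul, hLT, hLW, hX x hxU, hY x hxU]
    module
  have hcod : ∀ x ∈ V, fderiv ℝ b x (X x) - fderiv ℝ a x (Y x) = -2 * H * n x * b x ∧
      fderiv ℝ a x (X x) + fderiv ℝ b x (Y x) =
        -2 * n x * (a x * H - (a x ^ 2 + b x ^ 2)) := by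
    intro x hx
    have hxU := hx.1
    have hU := h.isOpen.mem_nhds hxU
    have hV := hVo.mem_nhds hx
    -- The same identity applied to ν is the Codazzi equation. Its normal part cancels, and its T
    -- and W parts are the two scalar equations.
    have e1 := VectorField.fderiv_apply_lieBracket (h.smooth_normal.contDiffAt hU)
      (by simpa using two_le_infty)
      ((hYs.contDiffAt hU).differentiableAt (by simp))
      ((hXs.contDiffAt hU).differentiableAt (by simp))
    have dT := ((hTU.contDiffAt hU).differentiableAt (by simp)).hasFDerivAt
    have dW := ((hWU.contDiffAt hU).differentiableAt (by simp)).hasFDerivAt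
    have da := ((haV.contDiffAt hV).differentiableAt (by simp)).hasFDerivAt
    have db := ((hbV.contDiffAt hV).differentiableAt (by simp)).hasFDerivAt
    have eY : HasFDerivAt (fun x => fderiv ℝ ν x (Y x)) _ x :=
      HasFDerivAt.congr_of_eventuallyEq ((db.smul dT).add ((da.const_sub H).smul dW)).neg (by
        filter_upwards [hV] with z hz using (hshape z hz).2.1)
    have eX : HasFDerivAt (fun x => fderiv ℝ ν x (X x)) _ x :=
      HasFDerivAt.congr_of_eventuallyEq (((da.const_add H).smul dT).add (db.smul dW)).neg (by
        filter_upwards [hV] with z hz using (hshape z hz).1)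
    rw [eY.fderiv, eX.fderiv, hbr x hx] at e1
    simp only [neg_apply, add_apply,
      smul_apply, ContinuousLinearMap.smulRight_apply, hTd x hxU,
      hWd x hxU, hnX x hx, hnY x hx, (hshape x hx).1, (hshape x hx).2.1, map_neg, map_add,
      map_sub, map_smul, hLT, hLW] at e1
    have e2 : (fderiv ℝ b x (X x) - fderiv ℝ a x (Y x) + 2 * H * n x * b x) • T x
        - (fderiv ℝ a x (X x) + fderiv ℝ b x (Y x)
          + 2 * n x * (a x * H - (a x ^ 2 + b x ^ 2))) • W x = 0 := by
      linear_combination (norm := module) e1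
    have e3 := congrArg (fun w => ⟪w, T x⟫_ℝ) e2
    have e4 := congrArg (fun w => ⟪w, W x⟫_ℝ) e2
    simp only [inner_sub_left, inner_smul_left, hTW x hxU, hTT x hxU, hWW x hxU,
      real_inner_comm (T x) (W x), inner_zero_left] at e3 e4
    simp [hx.2] at e3 e4
    exact ⟨by linarith, by linarith⟩
  refine ⟨a, b, X, Y, ?_⟩
  exact
    { isOpen := hVo
      smooth_n := hnU.mono hVU
      smooth_a := haV
      smooth_b := hbV
      smooth_X := hXs.mono hVU
      smooth_Y := hYs.mono hVU
      sq_ne := fun x hx => hx.2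
      norm_eq := fun x hx => (hshape x hx).2.2
      n_X := hnX
      n_Y := hnY
      bracket := hbr
      codazzi_fst := fun x hx => (hcod x hx).1
      codazzi_snd := fun x hx => (hcod x hx).2 }

/-- Where `v` is not normal, the angle `⟪ν, v⟫` is stationary, and it vanishes unless `H = 0`. -/
theorem rigidity (h : LocalSoliton U φ ν v H l) (hv : ‖v‖ = 1) {x : E2} (hx : x ∈ U)
    (hs : 1 - ⟪ν x, v⟫_ℝ ^ 2 ≠ 0) :
    (∀ Z, ⟪fderiv ℝ ν x Z, v⟫_ℝ = 0) ∧ (⟪ν x, v⟫_ℝ = 0 ∨ H = 0) := by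
  obtain ⟨a, b, X, Y, hsys⟩ := h.exists_solitonSystem hv
  refine ⟨fun Z => ?_, hsys.eq_zero_or_eq_zero ⟨hx, hs⟩⟩
  have hν := ((h.smooth_normal.contDiffAt (h.isOpen.mem_nhds hx)).differentiableAt
    (by simp)).hasFDerivAt
  have e1 : HasFDerivAt (fun x => ⟪ν x, v⟫_ℝ) _ x := hν.inner ℝ (hasFDerivAt_const v x)
  have e2 := hsys.fderiv_eq_zero ⟨hx, hs⟩
  rw [e1.fderiv] at e2
  simpa using congrArg (fun L : E2 →L[ℝ] ℝ => L Z) e2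

end LocalSoliton

end LocalSoliton

/-! ### Passage between the manifold and its charts -/

section Charts

variable {M : Type*} [TopologicalSpace M] [ChartedSpace (EuclideanSpace ℝ (Fin 2)) M]
  [IsManifold (𝓡 2) ∞ M]

/-- The coordinate expression of a smooth map, with its differential. -/
theorem chart_expression {F : M → E3} (hF : ContMDiff (𝓡 2) 𝓘(ℝ, E3) ∞ F) (p : M) :
    ContDiffOn ℝ ∞ (F ∘ (chartAt E2 p).symm) (chartAt E2 p).target ∧
    ∀ x ∈ (chartAt E2 p).target, ∀ Z : E2,
      fderiv ℝ (F ∘ (chartAt E2 p).symm) x Z =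
        differential F ((chartAt E2 p).symm x)
          (mfderiv (𝓡 2) (𝓡 2) (chartAt E2 p).symm x Z) := by
  constructor
  · rw [← contMDiffOn_iff_contDiffOn]
    exact hF.comp_contMDiffOn (contMDiffOn_chart_symm (I := 𝓡 2) (n := ∞) (x := p))
  · intro x hx Z
    have : IsManifold (𝓡 2) 1 M := IsManifold.of_le (n := ∞) (by simp)
    have h1 := (mdifferentiable_chart (I := 𝓡 2) p).mdifferentiableAt_symm hx
    have h2 : MDifferentiableAt (𝓡 2) 𝓘(ℝ, E3) F ((chartAt E2 p).symm x) :=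
      (hF _).mdifferentiableAt (by simp)
    have h3 := mfderiv_comp x h2 h1
    rw [← mfderiv_eq_fderiv]
    exact congrArg (fun L => L Z) h3

theorem chart_symm_differential_bijective (p : M) {x : E2} (hx : x ∈ (chartAt E2 p).target) :
    Function.Bijective (mfderiv (𝓡 2) (𝓡 2) (chartAt E2 p).symm x) := by
  have : IsManifold (𝓡 2) 1 M := IsManifold.of_le (n := ∞) (by simp)
  exact (mdifferentiable_chart (I := 𝓡 2) p).symm.mfderiv_bijective hx

/-- In a chart, a translating soliton of constant mean curvature is a local soliton. -/
theorem IsOrientedImmersion.localSoliton {Φ N : M → E3} (h : IsOrientedImmersion Φ N) {v : E3}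
    {H l : ℝ} (hK : IsTranslatingSoliton Φ N v l) (hH : ∀ p, meanCurvature Φ N p = H) (p : M) :
    LocalSoliton (chartAt E2 p).target (Φ ∘ (chartAt E2 p).symm) (N ∘ (chartAt E2 p).symm)
      v H l := by
  obtain ⟨hφ, hdφ⟩ := chart_expression h.smooth p
  obtain ⟨hν, hdν⟩ := chart_expression h.smooth_normal p
  refine ⟨(chartAt E2 p).open_target, hφ, hν, fun x hx => ?_, fun x hx => h.norm_normal _,
    fun x hx Z => ?_, fun x hx => ?_⟩
  · intro Z Z' hZ
    rw [hdφ x hx, hdφ x hx] at hZ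
    exact (chart_symm_differential_bijective p hx).1 (h.injective_differential _ hZ)
  · rw [hdφ x hx]
    exact h.normal_orthogonal _ _
  -- The differential of the inverse chart conjugates the coordinate shape operator to S, which
  -- preserves trace and determinant.
  · let A : E2 ≃ₗ[ℝ] TangentSpace (𝓡 2) ((chartAt E2 p).symm x) :=
      LinearEquiv.ofBijective
        (mfderiv (𝓡 2) (𝓡 2) (chartAt E2 p).symm x :
          TangentSpace (𝓡 2) x →ₗ[ℝ] TangentSpace (𝓡 2) ((chartAt E2 p).symm x))
        (chart_symm_differential_bijective p hx)
    refine ⟨A.symm.conj (shapeOperator Φ N ((chartAt E2 p).symm x)), fun Z => ?_, ?_, ?_⟩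
    · rw [hdφ x hx, hdν x hx]
      have e1 : mfderiv (𝓡 2) (𝓡 2) (chartAt E2 p).symm x
          (A.symm.conj (shapeOperator Φ N ((chartAt E2 p).symm x)) Z) =
          shapeOperator Φ N ((chartAt E2 p).symm x)
            (mfderiv (𝓡 2) (𝓡 2) (chartAt E2 p).symm x Z) :=
        A.apply_symm_apply _
      rw [e1]
      exact h.differential_shapeOperator _ _
    · rw [LinearMap.trace_conj']
      have := hH ((chartAt E2 p).symm x)
      unfold meanCurvature at this
      linarith
    · have e1 := LinearMap.det_conj (shapeOperator Φ N ((chartAt E2 p).symm x)) A.symm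
      exact e1.trans (hK ((chartAt E2 p).symm x))

/-- Transfers pointwise identities from a chart to the surface; one coordinate vector serves both
maps, so identities relating dΦ and dN carry over. -/
theorem chart_surjective {F G : M → E3} (hF : ContMDiff (𝓡 2) 𝓘(ℝ, E3) ∞ F)
    (hG : ContMDiff (𝓡 2) 𝓘(ℝ, E3) ∞ G) (p : M) (Z : TangentSpace (𝓡 2) p) :
    ∃ Z' : E2,
      fderiv ℝ (F ∘ (chartAt E2 p).symm) (chartAt E2 p p) Z' = differential F p Z ∧
      fderiv ℝ (G ∘ (chartAt E2 p).symm) (chartAt E2 p p) Z' = differential G p Z := by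
  have hx : chartAt E2 p p ∈ (chartAt E2 p).target := mem_chart_target E2 p
  have hp : (chartAt E2 p).symm (chartAt E2 p p) = p :=
    (chartAt E2 p).left_inv (mem_chart_source E2 p)
  -- Stated at `(chartAt E2 p).symm (chartAt E2 p p)` so that the tangent spaces match; the base
  -- point is rewritten to `p` afterwards.
  have key : ∀ Z : TangentSpace (𝓡 2) ((chartAt E2 p).symm (chartAt E2 p p)), ∃ Z' : E2,
      fderiv ℝ (F ∘ (chartAt E2 p).symm) (chartAt E2 p p) Z' = differential F _ Z ∧
      fderiv ℝ (G ∘ (chartAt E2 p).symm) (chartAt E2 p p) Z' = differential G _ Z := by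
    intro Z
    obtain ⟨Z', rfl⟩ := (chart_symm_differential_bijective p hx).2 Z
    exact ⟨Z', (chart_expression hF p).2 _ hx Z', (chart_expression hG p).2 _ hx Z'⟩
  rw [hp] at key
  exact key Z

/-- A combination of two smooth maps with vanishing differential is constant. -/
theorem eq_of_differential_eq_zero [ConnectedSpace M] {G : Type*} [NormedAddCommGroup G]
    [NormedSpace ℝ G] {F₁ F₂ : M → E3} (h₁ : ContMDiff (𝓡 2) 𝓘(ℝ, E3) ∞ F₁)
    (h₂ : ContMDiff (𝓡 2) 𝓘(ℝ, E3) ∞ F₂) (A B : E3 →L[ℝ] G)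
    (h : ∀ p Z, A (differential F₁ p Z) + B (differential F₂ p Z) = 0) (p q : M) :
    A (F₁ p) + B (F₂ p) = A (F₁ q) + B (F₂ q) := by
  have hloc : IsLocallyConstant fun p => A (F₁ p) + B (F₂ p) := by
    rw [IsLocallyConstant.iff_eventually_eq]
    intro p
    have hx : chartAt E2 p p ∈ (chartAt E2 p).target := mem_chart_target E2 p
    obtain ⟨r, hr, hball⟩ := Metric.isOpen_iff.1 (chartAt E2 p).open_target _ hx
    obtain ⟨s₁, d₁⟩ := chart_expression h₁ p
    obtain ⟨s₂, d₂⟩ := chart_expression h₂ p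
    have hD : ∀ x ∈ (chartAt E2 p).target,
        HasFDerivAt (fun x => A (F₁ ((chartAt E2 p).symm x)) + B (F₂ ((chartAt E2 p).symm x)))
          (0 : E2 →L[ℝ] G) x := by
      intro x hxt
      have hn := (chartAt E2 p).open_target.mem_nhds hxt
      have e₁ := ((s₁.contDiffAt hn).differentiableAt (by simp)).hasFDerivAt
      have e₂ := ((s₂.contDiffAt hn).differentiableAt (by simp)).hasFDerivAt
      refine ((A.hasFDerivAt.comp x e₁).add (B.hasFDerivAt.comp x e₂)).congr_fderiv ?_
      ext1 Z
      change A (fderiv ℝ (F₁ ∘ (chartAt E2 p).symm) x Z) +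
        B (fderiv ℝ (F₂ ∘ (chartAt E2 p).symm) x Z) = 0
      rw [d₁ x hxt, d₂ x hxt]
      exact h _ _
    have hs : (chartAt E2 p) ⁻¹' Metric.ball (chartAt E2 p p) r ∈ 𝓝 p :=
      ((chartAt E2 p).continuousAt (mem_chart_source E2 p)).preimage_mem_nhds
        (Metric.ball_mem_nhds _ hr)
    filter_upwards [hs, chart_source_mem_nhds E2 p] with q hq hqs
    have hc := (convex_ball (chartAt E2 p p) r).is_const_of_fderivWithin_eq_zero (𝕜 := ℝ)
      (f := fun x => A (F₁ ((chartAt E2 p).symm x)) + B (F₂ ((chartAt E2 p).symm x)))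
      (fun x hx => (hD x (hball hx)).differentiableAt.differentiableWithinAt)
      (fun x hx => by
        rw [fderivWithin_of_isOpen Metric.isOpen_ball hx, (hD x (hball hx)).fderiv])
      hq (Metric.mem_ball_self hr)
    simpa only [(chartAt E2 p).left_inv hqs, (chartAt E2 p).left_inv (mem_chart_source E2 p)]
      using hc
  exact hloc.apply_eq_of_preconnectedSpace p q

end Charts

/-! ### Tangent planes and normals -/

section Surface

variable {M : Type*} [TopologicalSpace M] [ChartedSpace (EuclideanSpace ℝ (Fin 2)) M]
  {Φ N : M → E3}

/-- A function of a smooth map which is constant has vanishing differential. -/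
theorem fderiv_differential_eq_zero {G : Type*} [NormedAddCommGroup G] [NormedSpace ℝ G]
    {F : M → E3} (hF : ContMDiff (𝓡 2) 𝓘(ℝ, E3) ∞ F) {g : E3 → G} {g' : E3 →L[ℝ] G} {p : M}
    (hg : HasFDerivAt g g' (F p)) {c : G} (hc : ∀ q, g (F q) = c) (Z : TangentSpace (𝓡 2) p) :
    g' (differential F p Z) = 0 := by
  have h1 : HasMFDerivAt (𝓡 2) 𝓘(ℝ, E3) F p (differential F p) :=
    ((hF p).mdifferentiableAt (by simp)).hasMFDerivAt
  have h2 := hg.hasMFDerivAt.comp p h1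
  have h3 : g ∘ F = fun _ => c := funext hc
  rw [h3] at h2
  exact congrArg (fun L => L Z) (hasMFDerivAt_unique h2 (hasMFDerivAt_const c p))

/-- The tangent plane is the orthogonal complement of the normal. -/
theorem IsOrientedImmersion.exists_differential_eq (h : IsOrientedImmersion Φ N) (p : M) {w : E3}
    (hw : ⟪N p, w⟫_ℝ = 0) : ∃ Z, differential Φ p Z = w := by
  set A : TangentSpace (𝓡 2) p →ₗ[ℝ] E3 := (differential Φ p : TangentSpace (𝓡 2) p →ₗ[ℝ] E3)
  have hle : LinearMap.range A ≤ (ℝ ∙ N p)ᗮ := by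
    rintro _ ⟨Y, rfl⟩
    rw [Submodule.mem_orthogonal_singleton_iff_inner_right]
    exact h.normal_orthogonal p Y
  have hN0 : N p ≠ 0 := by
    rw [← norm_ne_zero_iff, h.norm_normal p]
    exact one_ne_zero
  have hdim : Module.finrank ℝ (LinearMap.range A) = Module.finrank ℝ (ℝ ∙ N p)ᗮ := by
    have : Fact (Module.finrank ℝ E3 = 2 + 1) := ⟨by simp⟩
    rw [LinearMap.finrank_range_of_inj (h.injective_differential p),
      Submodule.finrank_orthogonal_span_singleton (n := 2) hN0]
    exact finrank_euclideanSpace_fin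
  have hmem : w ∈ LinearMap.range A := by
    rw [Submodule.eq_of_le_of_finrank_eq hle hdim,
      Submodule.mem_orthogonal_singleton_iff_inner_right]
    exact hw
  exact hmem

theorem IsOrientedImmersion.inner_normal_self (h : IsOrientedImmersion Φ N) (p : M) :
    ⟪N p, N p⟫_ℝ = 1 := by
  rw [real_inner_self_eq_norm_sq, h.norm_normal p, one_pow]

/-- A vector orthogonal to the tangent plane is normal. -/
theorem IsOrientedImmersion.eq_smul_normal (h : IsOrientedImmersion Φ N) (p : M) {w : E3}
    (hw : ∀ Z, ⟪w, differential Φ p Z⟫_ℝ = 0) : w = ⟪N p, w⟫_ℝ • N p := by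
  obtain ⟨Z, hZ⟩ := h.exists_differential_eq p (w := w - ⟪N p, w⟫_ℝ • N p) (by
    rw [inner_sub_right, inner_smul_right, h.inner_normal_self]; ring)
  rw [← sub_eq_zero, ← inner_self_eq_zero (𝕜 := ℝ)]
  have h1 := hw Z
  have h2 := h.normal_orthogonal p Z
  rw [hZ] at h1 h2
  rw [inner_sub_left, inner_smul_left, h1, h2]
  simp

end Surface

/-! ### Curvature in a frame and the classification -/

section Surface

variable {M : Type*} [TopologicalSpace M] [ChartedSpace (EuclideanSpace ℝ (Fin 2)) M]
  {Φ N : M → E3}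

theorem IsOrientedImmersion.shapeOperator_apply (h : IsOrientedImmersion Φ N) (p : M)
    {X Y : TangentSpace (𝓡 2) p} (hXY : differential Φ p Y = -differential N p X) :
    shapeOperator Φ N p X = Y :=
  h.injective_differential p ((h.differential_shapeOperator p X).trans hXY.symm)

theorem finrank_tangentSpace (p : M) : Module.finrank ℝ (TangentSpace (𝓡 2) p) = 2 :=
  finrank_euclideanSpace_fin

theorem IsOrientedImmersion.curvature_of_frame (h : IsOrientedImmersion Φ N) (p : M)
    {X Y : TangentSpace (𝓡 2) p} (hXY : LinearIndependent ℝ ![X, Y]) {c d e f : ℝ}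
    (hX : differential N p X = -(c • differential Φ p X + d • differential Φ p Y))
    (hY : differential N p Y = -(e • differential Φ p X + f • differential Φ p Y)) :
    2 * meanCurvature Φ N p = c + f ∧ gaussCurvature Φ N p = c * f - d * e := by
  obtain ⟨h1, h2⟩ := trace_det_of_frame (finrank_tangentSpace p) (shapeOperator Φ N p) hXY
    (p := c) (q := d) (r := e) (t := f)
    (h.shapeOperator_apply p (by rw [hX, neg_neg, map_add, map_smul, map_smul]))
    (h.shapeOperator_apply p (by rw [hY, neg_neg, map_add, map_smul, map_smul]))
  unfold meanCurvature gaussCurvature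
  rw [h1, h2]
  exact ⟨by ring, rfl⟩

theorem IsOrientedImmersion.curvature_of_differential_eq_zero (h : IsOrientedImmersion Φ N) (p : M)
    (hN : ∀ Z, differential N p Z = 0) : meanCurvature Φ N p = 0 ∧ gaussCurvature Φ N p = 0 := by
  have hS : shapeOperator Φ N p = 0 :=
    LinearMap.ext fun Z => h.shapeOperator_apply p (by rw [hN]; simp)
  unfold meanCurvature gaussCurvature
  have : Module.Finite ℝ (TangentSpace (𝓡 2) p) :=
    Module.finite_of_finrank_pos (by rw [finrank_tangentSpace]; exact two_pos)
  rw [hS, LinearMap.det_zero' (Module.finBasisOfFinrankEq ℝ (TangentSpace (𝓡 2) p)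
    (finrank_tangentSpace p)), map_zero]
  simp

/-- An orthogonal tangent frame containing the tangential part of a unit vector `v` which is not
normal. -/
theorem IsOrientedImmersion.exists_frame (h : IsOrientedImmersion Φ N) {v : E3} (hv : ‖v‖ = 1)
    (p : M) (hs : 1 - ⟪N p, v⟫_ℝ ^ 2 ≠ 0) :
    ∃ X Y : TangentSpace (𝓡 2) p, LinearIndependent ℝ ![X, Y] ∧
      differential Φ p X = v - ⟪N p, v⟫_ℝ • N p ∧
      ⟪differential Φ p X, differential Φ p Y⟫_ℝ = 0 ∧
      ⟪v, differential Φ p Y⟫_ℝ = 0 ∧ differential Φ p Y ≠ 0 := by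
  obtain ⟨L, hL, hLL⟩ := exists_skew_map hv
  have hvv : ⟪v, v⟫_ℝ = 1 := by rw [real_inner_self_eq_norm_sq, hv]; norm_num
  have hNN := h.inner_normal_self p
  have hLN : ⟪N p, L (N p)⟫_ℝ = 0 := by
    have := hL (N p) (N p)
    rw [real_inner_comm] at this
    linarith
  have hLv : L v = 0 := by
    rw [← inner_self_eq_zero (𝕜 := ℝ), hL, hLL, hvv]
    simp
  have hvL : ⟪v, L (N p)⟫_ℝ = 0 := by
    rw [real_inner_comm, hL, hLv, inner_zero_right, neg_zero]
  have hWW : ⟪L (N p), L (N p)⟫_ℝ = 1 - ⟪N p, v⟫_ℝ ^ 2 := by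
    simp only [hL, hLL, inner_sub_right, inner_smul_right, hNN]
    ring
  obtain ⟨X, hX⟩ := h.exists_differential_eq p (w := v - ⟪N p, v⟫_ℝ • N p) (by
    rw [inner_sub_right, inner_smul_right, hNN]; ring)
  obtain ⟨Y, hY⟩ := h.exists_differential_eq p hLN
  have horth : ⟪differential Φ p X, differential Φ p Y⟫_ℝ = 0 := by
    rw [hX, hY, inner_sub_left, inner_smul_left, hvL, hLN]
    simp
  have hY0 : differential Φ p Y ≠ 0 := by
    rw [hY, ← inner_self_ne_zero (𝕜 := ℝ), hWW]
    exact hs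
  have hX0 : differential Φ p X ≠ 0 := by
    intro h0
    apply hs
    rw [hX] at h0
    have := congrArg (fun w => ⟪w, v⟫_ℝ) h0
    simp only [inner_sub_left, inner_smul_left, hvv, inner_zero_left] at this
    simp at this
    linarith
  refine ⟨X, Y, linearIndependent_pair_of_orthogonal
    (differential Φ p : TangentSpace (𝓡 2) p →ₗ[ℝ] E3) horth hX0 hY0, hX, horth, ?_, hY0⟩
  rw [hY, hvL]

/-- If `dN` is orthogonal to `v` where `v` is not normal, then the tangential part of `v` is a
principal direction with principal curvature zero. -/
theorem IsOrientedImmersion.differential_normal_eq (h : IsOrientedImmersion Φ N) {v : E3}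
    (hv : ‖v‖ = 1) (p : M) (hs : 1 - ⟪N p, v⟫_ℝ ^ 2 ≠ 0)
    (hsymm : ∀ Z Z', ⟪differential N p Z, differential Φ p Z'⟫_ℝ =
      ⟪differential N p Z', differential Φ p Z⟫_ℝ)
    (hNv : ∀ Z, ⟪differential N p Z, v⟫_ℝ = 0) (Z : TangentSpace (𝓡 2) p) :
    differential N p Z = -(2 * meanCurvature Φ N p) • (differential Φ p Z -
      (⟪differential Φ p Z, v⟫_ℝ / (1 - ⟪N p, v⟫_ℝ ^ 2)) • (v - ⟪N p, v⟫_ℝ • N p)) := by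
  obtain ⟨X, Y, hind, hX, hXY, hvY, hY0⟩ := h.exists_frame hv p hs
  have hvv : ⟪v, v⟫_ℝ = 1 := by rw [real_inner_self_eq_norm_sq, hv]; norm_num
  have hcoord := exists_coordinates (finrank_tangentSpace p) hind
  have hXv : ⟪differential Φ p X, v⟫_ℝ = 1 - ⟪N p, v⟫_ℝ ^ 2 := by
    rw [hX, inner_sub_left, inner_smul_left, hvv]
    simp
    ring
  -- dN(Z) is orthogonal to v and to N, hence to T = dΦ(X).
  have hXT : ∀ Z, ⟪differential N p Z, differential Φ p X⟫_ℝ = 0 := fun Z => by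
    rw [hX, inner_sub_right, inner_smul_right, hNv, real_inner_comm (N p),
      h.inner_differential_normal]
    ring
  have hXX : ⟪differential Φ p X, differential Φ p X⟫_ℝ = 1 - ⟪N p, v⟫_ℝ ^ 2 := by
    have : ⟪differential Φ p X, differential Φ p X⟫_ℝ =
        ⟪differential Φ p X, v - ⟪N p, v⟫_ℝ • N p⟫_ℝ := by rw [← hX]
    rw [this, inner_sub_right, inner_smul_right, hXv, real_inner_comm (N p), h.normal_orthogonal]
    ring
  have hdN : ∀ Z, ∃ t : ℝ, differential N p Z = t • differential Φ p Y := by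
    intro Z
    obtain ⟨W, hW⟩ := h.exists_differential_eq p (h.inner_differential_normal p Z)
    obtain ⟨x, y, rfl⟩ := hcoord W
    rw [map_add, map_smul, map_smul] at hW
    have := hXT Z
    rw [← hW, inner_add_left, inner_smul_left, inner_smul_left, hXX,
      real_inner_comm (differential Φ p X) (differential Φ p Y), hXY] at this
    simp [hs] at this
    exact ⟨y, by rw [← hW, this, zero_smul, zero_add]⟩
  obtain ⟨t, ht⟩ := hdN Y
  obtain ⟨u, hu⟩ := hdN X
  -- By symmetry ⟨dN(X), dΦ(Y)⟩ = ⟨dN(Y), dΦ(X)⟩ = 0, so X is principal with curvature 0 and the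
  -- trace of S is -t.
  have hu0 : u = 0 := by
    have := hsymm X Y
    rw [hXT, hu, inner_smul_left] at this
    simpa [hY0] using this
  rw [hu0, zero_smul] at hu
  have hmean := (h.curvature_of_frame p hind (c := 0) (d := 0) (e := 0) (f := -t)
    (by rw [hu]; simp) (by rw [ht]; simp)).1
  obtain ⟨x, y, rfl⟩ := hcoord Z
  have e1 : ⟪differential Φ p (x • X + y • Y), v⟫_ℝ / (1 - ⟪N p, v⟫_ℝ ^ 2) = x := by
    rw [map_add, map_smul, map_smul, inner_add_left, inner_smul_left, inner_smul_left, hXv,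
      real_inner_comm v (differential Φ p Y), hvY]
    field_simp
    simp [mul_comm]
  rw [e1, ← hX, hmean]
  simp only [map_add, map_smul, hu, ht]
  module

/-- If the normal is constant, the surface lies in a plane. -/
theorem IsOrientedImmersion.subset_plane [IsManifold (𝓡 2) ∞ M] [ConnectedSpace M]
    (h : IsOrientedImmersion Φ N) (hN : ∀ p q, N p = N q) :
    ∃ a w : E3, ‖w‖ = 1 ∧ Set.range Φ ⊆ plane a w := by
  obtain ⟨p₀⟩ := (inferInstance : Nonempty M)
  refine ⟨Φ p₀, N p₀, h.norm_normal p₀, ?_⟩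
  rintro _ ⟨p, rfl⟩
  have := eq_of_differential_eq_zero h.smooth h.smooth (innerSL ℝ (N p₀)) 0
    (fun q Z => by
      rw [hN p₀ q]
      simpa using h.normal_orthogonal q Z) p p₀
  simp at this
  change ⟪Φ p - Φ p₀, N p₀⟫_ℝ = 0
  rw [inner_sub_left, real_inner_comm, this, real_inner_comm, sub_self]

/-- The projection onto the plane orthogonal to `v`. -/
noncomputable def axialProjection (v : E3) : E3 →L[ℝ] E3 :=
  ContinuousLinearMap.id ℝ E3 - (innerSL ℝ v).smulRight v

theorem axialProjection_apply (v x : E3) : axialProjection v x = x - ⟪x, v⟫_ℝ • v := by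
  simp [axialProjection, real_inner_comm]

/-- Constant mean curvature translating solitons lie in planes or cylinders. -/
theorem IsOrientedImmersion.plane_or_cylinder [IsManifold (𝓡 2) ∞ M] [ConnectedSpace M]
    (h : IsOrientedImmersion Φ N) {v : E3} (hv : ‖v‖ = 1) {l : ℝ} (hK : IsTranslatingSoliton Φ N v l)
    (hH : HasConstantMeanCurvature Φ N) :
    (∃ a w : E3, ‖w‖ = 1 ∧ Set.range Φ ⊆ plane a w) ∨
      ∃ (a u : E3) (r : ℝ), ‖u‖ = 1 ∧ 0 < r ∧ Set.range Φ ⊆ circularCylinder a u r := by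
  obtain ⟨H, hH⟩ := hH
  have hvv : ⟪v, v⟫_ℝ = 1 := by rw [real_inner_self_eq_norm_sq, hv]; norm_num
  have hloc := h.localSoliton hK hH
  have hmem : ∀ p : M, chartAt E2 p p ∈ (chartAt E2 p).target := fun p => mem_chart_target E2 p
  have hleft : ∀ p : M, (N ∘ (chartAt E2 p).symm) (chartAt E2 p p) = N p := fun p =>
    congrArg N ((chartAt E2 p).left_inv (mem_chart_source E2 p))
  have hnormal : ∀ p, 1 - ⟪N p, v⟫_ℝ ^ 2 = 0 → N p = ⟪N p, v⟫_ℝ • v := by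
    intro p hp
    rw [← sub_eq_zero, ← inner_self_eq_zero (𝕜 := ℝ)]
    simp only [inner_sub_left, inner_sub_right, inner_smul_left, inner_smul_right, hvv,
      h.inner_normal_self p, real_inner_comm (N p) v]
    simp
    linarith
  have hsymm : ∀ p Z Z', ⟪differential N p Z, differential Φ p Z'⟫_ℝ =
      ⟪differential N p Z', differential Φ p Z⟫_ℝ := by
    intro p Z Z'
    obtain ⟨A, hA₁, hA₂⟩ := chart_surjective h.smooth h.smooth_normal p Z
    obtain ⟨A', hA'₁, hA'₂⟩ := chart_surjective h.smooth h.smooth_normal p Z'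
    rw [← hA₁, ← hA₂, ← hA'₁, ← hA'₂]
    exact (hloc p).symmetric (hmem p) A A'
  have hrig : ∀ p, 1 - ⟪N p, v⟫_ℝ ^ 2 ≠ 0 →
      (∀ Z, ⟪differential N p Z, v⟫_ℝ = 0) ∧ (⟪N p, v⟫_ℝ = 0 ∨ H = 0) := by
    intro p hs
    have := (hloc p).rigidity hv (hmem p) (by rw [hleft p]; exact hs)
    rw [hleft p] at this
    refine ⟨fun Z => ?_, this.2⟩
    obtain ⟨A, -, hA⟩ := chart_surjective h.smooth h.smooth_normal p Z
    rw [← hA]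
    exact this.1 A
  -- At points where v is normal, N = ±v, and dN ⊥ N already gives the claim.
  have hdn : ∀ p Z, ⟪differential N p Z, v⟫_ℝ = 0 := by
    intro p Z
    by_cases hs : 1 - ⟪N p, v⟫_ℝ ^ 2 = 0
    · have e1 := h.inner_differential_normal p Z
      rw [hnormal p hs, inner_smul_left, real_inner_comm (differential N p Z) v] at e1
      rcases mul_eq_zero.1 e1 with h0 | h0
      · have h0' : ⟪N p, v⟫_ℝ = 0 := h0
        rw [h0'] at hs
        norm_num at hs
      · exact h0
    · exact (hrig p hs).1 Z
  have hnc : ∀ p q, ⟪N p, v⟫_ℝ = ⟪N q, v⟫_ℝ := by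
    intro p q
    have := eq_of_differential_eq_zero h.smooth h.smooth_normal 0 (innerSL ℝ v)
      (fun q Z => by simpa [real_inner_comm] using hdn q Z) p q
    simpa [real_inner_comm] using this
  obtain ⟨p₀⟩ := (inferInstance : Nonempty M)
  by_cases hs : 1 - ⟪N p₀, v⟫_ℝ ^ 2 = 0
  · left
    refine h.subset_plane fun p q => ?_
    rw [hnormal p (by rw [hnc p p₀]; exact hs), hnormal q (by rw [hnc q p₀]; exact hs),
      hnc p q]
  have hsp : ∀ p, 1 - ⟪N p, v⟫_ℝ ^ 2 ≠ 0 := fun p => by rwa [hnc p p₀]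
  have hdN := fun p => h.differential_normal_eq hv p (hsp p) (hsymm p) (hdn p)
  by_cases hH0 : H = 0
  · left
    refine h.subset_plane fun p q => ?_
    have := eq_of_differential_eq_zero h.smooth h.smooth_normal 0 (ContinuousLinearMap.id ℝ E3)
      (fun q Z => by
        have := hdN q Z
        rw [hH q, hH0] at this
        simpa using this) p q
    simpa using this
  right
  have hn0 : ∀ p, ⟪N p, v⟫_ℝ = 0 := fun p => ((hrig p (hsp p)).2).resolve_right hH0
  -- With n = 0 the tangential part of v is v itself, so dN = -2H P dΦ and PΦ + N/(2H) has zero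
  -- differential.
  have hcenter := fun p => eq_of_differential_eq_zero h.smooth h.smooth_normal
    (axialProjection v) ((2 * H)⁻¹ • ContinuousLinearMap.id ℝ E3)
    (fun q Z => by
      have := hdN q Z
      rw [hH q, hn0 q] at this
      rw [this, axialProjection_apply]
      simp
      rw [smul_smul, ← sub_eq_add_neg, sub_eq_zero]
      rw [show H⁻¹ * 2⁻¹ * (2 * H) = 1 by field_simp, one_smul]) p p₀
  set c := axialProjection v (Φ p₀) + ((2 * H)⁻¹ • ContinuousLinearMap.id ℝ E3) (N p₀) with hc
  -- Since c ⊥ v, the component of Φ - c orthogonal to v is PΦ - c = -N/(2H), of length 1/|2H|.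
  have hcv : ⟪c, v⟫_ℝ = 0 := by
    rw [hc, axialProjection_apply]
    simp [inner_add_left, inner_sub_left, inner_smul_left, hv, hn0]
  refine ⟨c, v, ‖(2 * H)⁻¹‖, hv, norm_pos_iff.2 (by positivity), ?_⟩
  rintro _ ⟨p, rfl⟩
  change ‖(Φ p - c) - ⟪Φ p - c, v⟫_ℝ • v‖ = ‖(2 * H)⁻¹‖
  rw [inner_sub_left, hcv, sub_zero, ← hcenter p, axialProjection_apply]
  rw [show Φ p - (Φ p - ⟪Φ p, v⟫_ℝ • v + ((2 * H)⁻¹ • ContinuousLinearMap.id ℝ E3) (N p)) -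
    ⟪Φ p, v⟫_ℝ • v = -((2 * H)⁻¹ • N p) by simp; module]
  rw [norm_neg, norm_smul, h.norm_normal, mul_one]

/-! ### The converse: planes and cylinders -/

/-- A continuous function on a connected space whose square is a positive constant is constant. -/
theorem eq_of_sq_eq {P : Type*} [TopologicalSpace P] [ConnectedSpace P] {f : P → ℝ}
    (hf : Continuous f) {r : ℝ} (hr : r ≠ 0) (h : ∀ p, f p ^ 2 = r ^ 2) (p q : P) : f p = f q := by
  have := (isPreconnected_univ (α := P)).eq_or_eq_neg_of_sq_eq hf.continuousOn
    (continuousOn_const (c := r)) (fun p _ => h p) (fun _ => hr)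
  rcases this with h1 | h1
  · rw [h1 (Set.mem_univ p), h1 (Set.mem_univ q)]
  · rw [h1 (Set.mem_univ p), h1 (Set.mem_univ q)]
    rfl

/-- Surfaces in planes are translating solitons of constant mean curvature. -/
theorem IsOrientedImmersion.soliton_of_plane [ConnectedSpace M] (h : IsOrientedImmersion Φ N)
    (v : E3) {a w : E3} (hw : ‖w‖ = 1) (hsub : Set.range Φ ⊆ plane a w) :
    HasConstantMeanCurvature Φ N ∧ ∃ l : ℝ, IsTranslatingSoliton Φ N v l := by
  have horth : ∀ p Z, ⟪w, differential Φ p Z⟫_ℝ = 0 := by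
    intro p Z
    have hd : HasFDerivAt (fun x : E3 => innerSL ℝ w (x - a)) (innerSL ℝ w) (Φ p) :=
      (innerSL ℝ w).hasFDerivAt.comp (Φ p) ((hasFDerivAt_id (Φ p)).sub_const a)
    have := fderiv_differential_eq_zero h.smooth hd (c := (0 : ℝ)) (fun q => by
      have h1 : ⟪Φ q - a, w⟫_ℝ = 0 := hsub ⟨q, rfl⟩
      rw [innerSL_apply_apply, real_inner_comm, h1]) Z
    simpa using this
  -- Hence w = ±N, and connectedness makes the sign constant.
  have hwN := fun p => h.eq_smul_normal p (horth p)
  have hsq : ∀ p, ⟪N p, w⟫_ℝ ^ 2 = 1 ^ 2 := by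
    intro p
    have := congrArg norm (hwN p)
    rw [hw, norm_smul, h.norm_normal, mul_one, Real.norm_eq_abs] at this
    rw [← sq_abs, ← this]
  have hconst := eq_of_sq_eq (f := fun p => ⟪N p, w⟫_ℝ)
    (h.smooth_normal.continuous.inner continuous_const) one_ne_zero hsq
  obtain ⟨p₀⟩ := (inferInstance : Nonempty M)
  have hN : ∀ p, N p = ⟪N p₀, w⟫_ℝ • w := by
    intro p
    have h1 : ⟪N p, w⟫_ℝ = ⟪N p₀, w⟫_ℝ := hconst p p₀
    have h2 : ⟪N p₀, w⟫_ℝ • w = ⟪N p, w⟫_ℝ • ⟪N p, w⟫_ℝ • N p := by rw [← hwN p, h1]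
    rw [h2, smul_smul, ← pow_two, hsq p, one_pow, one_smul]
  have hdN : ∀ p Z, differential N p Z = 0 := fun p Z =>
    fderiv_differential_eq_zero h.smooth_normal (hasFDerivAt_id (N p)) hN Z
  have hcurv := fun p => h.curvature_of_differential_eq_zero p (hdN p)
  refine ⟨⟨0, fun p => (hcurv p).1⟩, -⟪N p₀, v⟫_ℝ, fun p => ?_⟩
  rw [(hcurv p).2, hN p, ← hN p₀]
  ring

/-- Surfaces in a circular cylinder with axis parallel to the direction are translating solitons
of constant mean curvature. -/
theorem IsOrientedImmersion.soliton_of_cylinder [ConnectedSpace M] (h : IsOrientedImmersion Φ N)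
    {v : E3} (hv : ‖v‖ = 1) {a : E3} {r : ℝ} (hr : 0 < r)
    (hsub : Set.range Φ ⊆ circularCylinder a v r) :
    HasConstantMeanCurvature Φ N ∧ IsTranslatingSoliton Φ N v 0 := by
  have hvv : ⟪v, v⟫_ℝ = 1 := by rw [real_inner_self_eq_norm_sq, hv]; norm_num
  have hPv : ∀ x, ⟪axialProjection v x, v⟫_ℝ = 0 := fun x => by
    rw [axialProjection_apply, inner_sub_left, inner_smul_left, hvv]
    simp
  have hPP : ∀ x y, ⟪axialProjection v x, axialProjection v y⟫_ℝ = ⟪axialProjection v x, y⟫_ℝ :=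
    fun x y => by
      rw [axialProjection_apply v y, inner_sub_right, inner_smul_right, hPv, mul_zero, sub_zero]
  -- Q is the radial vector from the axis. Its constant length makes it orthogonal to the surface,
  -- so Q = ±rN.
  set Q : M → E3 := fun p => axialProjection v (Φ p - a) with hQ
  have hQr : ∀ p, ⟪Q p, Q p⟫_ℝ = r ^ 2 := by
    intro p
    have h1 : ‖(Φ p - a) - ⟪Φ p - a, v⟫_ℝ • v‖ = r := hsub ⟨p, rfl⟩
    rw [← axialProjection_apply] at h1
    rw [real_inner_self_eq_norm_sq, hQ, h1]
  have horth : ∀ p Z, ⟪Q p, differential Φ p Z⟫_ℝ = 0 := by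
    intro p Z
    have hd : HasFDerivAt (fun x : E3 => axialProjection v (x - a)) (axialProjection v) (Φ p) :=
      (axialProjection v).hasFDerivAt.comp (Φ p) ((hasFDerivAt_id (Φ p)).sub_const a)
    have := fderiv_differential_eq_zero h.smooth (hd.inner ℝ hd) (c := r ^ 2) hQr Z
    simp [real_inner_comm] at this
    rw [← hPP]
    have h2 : axialProjection v (Φ p) - axialProjection v a = Q p := by simp [hQ]
    rw [h2] at this
    rw [real_inner_comm]
    exact this
  have hQN := fun p => h.eq_smul_normal p (horth p)
  have hsq : ∀ p, ⟪N p, Q p⟫_ℝ ^ 2 = r ^ 2 := by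
    intro p
    have := hQr p
    rw [hQN p, inner_smul_left, inner_smul_right, h.inner_normal_self] at this
    simp at this
    rw [← this]
    ring
  have hQc : Continuous Q :=
    (axialProjection v).continuous.comp (h.smooth.continuous.sub continuous_const)
  have hconst := eq_of_sq_eq (f := fun p => ⟪N p, Q p⟫_ℝ)
    (h.smooth_normal.continuous.inner hQc) hr.ne' hsq
  obtain ⟨p₀⟩ := (inferInstance : Nonempty M)
  -- The inner product is ±r, so c = ±1/r, with a sign independent of the point.
  set c := ⟪N p₀, Q p₀⟫_ℝ / r ^ 2 with hc
  have hN : ∀ p, N p = c • Q p := by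
    intro p
    have h1 : ⟪N p, Q p⟫_ℝ = ⟪N p₀, Q p₀⟫_ℝ := hconst p p₀
    rw [hQN p, smul_smul, hc, ← h1, div_mul_eq_mul_div, ← pow_two, hsq p,
      div_self (pow_ne_zero 2 hr.ne'), one_smul]
  have hNv : ∀ p, ⟪N p, v⟫_ℝ = 0 := fun p => by
    rw [hN p, inner_smul_left, hPv, mul_zero]
  have hdN : ∀ p Z, differential N p Z = c • axialProjection v (differential Φ p Z) := by
    intro p Z
    have h1 : HasMFDerivAt (𝓡 2) 𝓘(ℝ, E3) Φ p (differential Φ p) :=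
      ((h.smooth p).mdifferentiableAt (by simp)).hasMFDerivAt
    have hd : HasFDerivAt (fun x : E3 => c • axialProjection v (x - a))
        (c • axialProjection v) (Φ p) :=
      ((axialProjection v).hasFDerivAt.comp (Φ p) ((hasFDerivAt_id (Φ p)).sub_const a)).const_smul c
    have h2 := hd.hasMFDerivAt.comp p h1
    have h3 : (fun x : E3 => c • axialProjection v (x - a)) ∘ Φ = N := funext fun q => (hN q).symm
    rw [h3] at h2
    exact congrArg (fun L => L Z) h2.mfderiv
  have hcurv : ∀ p, 2 * meanCurvature Φ N p = 0 + -c ∧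
      gaussCurvature Φ N p = 0 * (-c) - 0 * 0 := by
    intro p
    -- Since n = 0, dΦ(X) = v is killed by the projection while dΦ(Y) is fixed; the principal
    -- curvatures are 0 and -c.
    obtain ⟨X, Y, hind, hX, hXY, hvY, hY0⟩ := h.exists_frame hv p (by rw [hNv p]; norm_num)
    refine h.curvature_of_frame p hind ?_ ?_
    · rw [hdN, axialProjection_apply, hX, hNv p]
      simp [hv]
    · rw [hdN, axialProjection_apply, real_inner_comm, hvY]
      simp
  refine ⟨⟨-c / 2, fun p => ?_⟩, fun p => ?_⟩
  · linarith [(hcurv p).1]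
  · rw [(hcurv p).2, hNv p]
    ring

end Surface

end GaussFlow

theorem theorem1p1 {M : Type*} [TopologicalSpace M]
    [ChartedSpace (EuclideanSpace ℝ (Fin 2)) M] [IsManifold (𝓡 2) ∞ M] [ConnectedSpace M]
    (Φ N : M → E3) (hΦ : GaussFlow.IsOrientedImmersion Φ N) (v : E3) (hv : ‖v‖ = 1) :
    (∀ l : ℝ, GaussFlow.IsTranslatingSoliton Φ N v l →
      GaussFlow.HasConstantMeanCurvature Φ N →
        (∃ a w : E3, ‖w‖ = 1 ∧ Set.range Φ ⊆ GaussFlow.plane a w) ∨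
        (∃ (a u : E3) (r : ℝ), ‖u‖ = 1 ∧ 0 < r ∧
          Set.range Φ ⊆ GaussFlow.circularCylinder a u r)) ∧
    (∀ a w : E3, ‖w‖ = 1 → Set.range Φ ⊆ GaussFlow.plane a w →
      GaussFlow.HasConstantMeanCurvature Φ N ∧
        ∃ l : ℝ, GaussFlow.IsTranslatingSoliton Φ N v l) ∧
    (∀ (a : E3) (r : ℝ), 0 < r → Set.range Φ ⊆ GaussFlow.circularCylinder a v r →
      GaussFlow.HasConstantMeanCurvature Φ N ∧
        GaussFlow.IsTranslatingSoliton Φ N v 0) := by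
  refine ⟨fun l hK hH => hΦ.plane_or_cylinder hv hK hH, fun a w hw hsub => ?_,
    fun a r hr hsub => ?_⟩
  · exact hΦ.soliton_of_plane v hw hsub
  · exact hΦ.soliton_of_cylinder hv hr hsub
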